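/- Let $N\ge 0$ be an integer, and let $b_1,\dots,b_{2N+1}$, $\bar b_1,\bar b_3,\dots,\bar b_{2N+1}$ be complex coupling constants, with $b_j=\bar b_j=0$ for every index outside these ranges. Consider the unital associative complex algebra $\mathcal A$ generated by $h_1,\dots,h_{2N+1}$ and $h_{\bar 1},h_{\bar 3},\dots,h_{\overline{2N+1}}$, where a generator whose coupling is zero (or whose index is out of range) is $0$, with the following relations. One has $h_j^2=b_j^2$ and $h_{\bar j}^2=\bar b_j^2$. The generators $h_i,h_j$ anticommute if $1\le|i-j|\le 2$; $h_{\overline{2k+1}}$ anticommutes with $h_{2k-5},h_{2k-3},h_{2k-1},h_{2k+1},h_{2k},h_{2k+2}$ and with $h_{\overline{2k-1}},h_{\overline{2k+3}}$; all other pairs commute. With $$S_{2m}=h_{2m-1}+h_{2m}+h_{\overline{2m+1}},\quad A_{2m-1}=h_{2m}h_{2m-3}+h_{2m-2}h_{\overline{2m+1}},\quad C_{2m}=h_{2m-3}h_{\overline{2m+3}},$$ one moreover imposes $A_{2m-1}C_{2m+2}=C_{2m}A_{2m+3}$ for $1<m<N-1$. For $M\le 2N+1$ let $G_M$ be the graph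 on the labels $1,\dots,M,\bar 1,\bar 3,\dots,\overline{2\lfloor M/2\rfloor+1}$ (the empty graph for $M<0$) in which two labels are joined when the corresponding generators are prescribed above to anticommute. Let $Q_M^{(k)}$ be the sum, over the independent sets of $k$ vertices of $G_M$, of the products of the corresponding generators, let $T_M(u)=\sum_{k\ge0}(-u)^kQ_M^{(k)}$, and let $S_M$ be the independence number of the subgraph of $G_M$ induced on the labels with nonzero coupling. (i) For $2\le m\le N$ the product over an even hole $\mu_{2m-1}=h_{2m-3}h_{2m}h_{2m-2}h_{\overline{2m+1}}$ is central in $\mathcal A$, and $\mu_{2m-1}^2=(b_{2m-3}b_{2m}b_{2m-2}\bar b_{2m+1})^2$. For $1\le m\le N$, $S_{2m}^2=b_{2m-1}^2+b_{2m}^2+\bar b_{2m+1}^2$ and $C_{2m-2}^2=-b_{2m-5}^2\bar b_{2m+1}^2$. (ii) If $0\le M\le 2N+1$ and $b_1,\dots,b_M\ne0$, then $S_M=\lfloor (M+2)/3\rfloor$ when $\bar b_1=0$, and $S_M=\lfloor M/3\rfloor+1$ when $\bar b_1\neq0$. (iii) For every choice of signs $\varepsilon_m=\pm1$ there are polynomials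 $P_M(z)\in\mathbb C[z]$, depending only on the couplings and the signs, with $P_M=1$ for $M<0$, $P_0(z)=1-\bar b_1^2z$ (so $P_0=1$ if $\bar b_1=0$), $$P_{2m}(u^2)=P_{2m-2}(u^2)-u^2\,(b_{2m-1}^2+b_{2m}^2+\bar b_{2m+1}^2)\,P_{2m-4}(u^2)+u^4\,(b_{2m-3}b_{2m}+\varepsilon_m b_{2m-2}\bar b_{2m+1})^2\,P_{2m-6}(u^2)-u^4\,b_{2m-5}^2\bar b_{2m+1}^2\,P_{2m-8}(u^2)$$ for $1\le m\le N$, and $$P_{2m-1}(u^2)=P_{2m-2}(u^2)-u^2\,b_{2m-1}^2\,P_{2m-4}(u^2)$$ for $1\le m\le N+1$, such that the following holds in every representation of $\mathcal A$ in a nonzero unital complex algebra in which $\mu_{2m-1}=\varepsilon_m b_{2m-3}b_{2m}b_{2m-2}\bar b_{2m+1}$ for $2\le m\le N$. One has $A_{2m-1}^2=(b_{2m-3}b_{2m}+\varepsilon_m b_{2m-2}\bar b_{2m+1})^2$ for $1\le m\le N$. For all $-2\le M\le 2N+1$ and all $u\in\mathbb C$, $$T_M(u)\,T_M(-u)=P_M(u^2)\cdot\mathbb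 1 .$$ Moreover $\deg P_M\le S_M$, with equality if and only if $\bigl(Q_M^{(S_M)}\bigr)^2\ne0$ in that representation. (iv) Let $0\le M\le 2N+1$. If all couplings are real, $b_1,\dots,b_M\neq0$, and $b_{2m-3}b_{2m}+\varepsilon_m b_{2m-2}\bar b_{2m+1}\ne0$ for all $m\ge2$ with $2m\le M$, then $\deg P_M=S_M$. -/

import Mathlib

namespace ExtendedFFD

/-- Labels of the generators: `ffd j` labels `h_j`, and `bar k` labels the additional generator
`h_{\overline{2k+1}}`. -/
inductive Vertex where
  | ffd (j : ℤ)
  | bar (k : ℤ)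
  deriving DecidableEq

open Vertex

/-- Adjacency of the frustration graph: two generators anticommute iff their labels are adjacent.
`h_i`, `h_j` are adjacent when the indices are neighbouring or next to neighbouring;
`h_{\overline{2k+1}}` is adjacent to `h_{2k-5}, h_{2k-3}, h_{2k-1}, h_{2k+1}, h_{2k}, h_{2k+2}` and
to `h_{\overline{2k-1}}, h_{\overline{2k+3}}`. -/
def Adj : Vertex → Vertex → Prop
  | ffd i, ffd j => i ≠ j ∧ |i - j| ≤ 2
  | bar k, bar l => |k - l| = 1
  | ffd i, bar k => i ∈ ({2 * k - 5, 2 * k - 3, 2 * k - 1, 2 * k + 1, 2 * k, 2 * k + 2} : Set ℤ)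
  | bar k, ffd i => i ∈ ({2 * k - 5, 2 * k - 3, 2 * k - 1, 2 * k + 1, 2 * k, 2 * k + 2} : Set ℤ)

/-- The frustration graph on all labels; `G_M` is its restriction to `vertexSet M`. -/
noncomputable def frustrationGraph : SimpleGraph Vertex where
  Adj := Adj
  symm := ⟨by
    rintro (i | k) (j | l) h
    · exact ⟨h.1.symm, by rw [abs_sub_comm]; exact h.2⟩
    · exact h
    · exact h
    · change |l - k| = 1
      rw [abs_sub_comm]; exact h⟩
  loopless := ⟨by
    rintro (i | k) h
    · exact h.1 rfl
    · have h' : |k - k| = 1 := h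
      simp at h'⟩

/-- `V_M = {1, …, M} ∪ {\overline 1, \overline 3, …, \overline{2⌊M/2⌋+1}}` (empty for `M < 0`). -/
noncomputable def vertexSet (M : ℤ) : Finset Vertex :=
  (Finset.Icc 1 M).image ffd ∪ (Finset.Icc 0 (M / 2)).image bar

section Elements

variable {R : Type*} [Ring R] (h : Vertex → R)

/-- `S_{2m} = h_{2m-1} + h_{2m} + h_{\overline{2m+1}}`. -/
def opS (m : ℤ) : R := h (ffd (2 * m - 1)) + h (ffd (2 * m)) + h (bar m)

/-- `A_{2m-1} = h_{2m} h_{2m-3} + h_{2m-2} h_{\overline{2m+1}}`. -/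
def opA (m : ℤ) : R :=
  h (ffd (2 * m)) * h (ffd (2 * m - 3)) + h (ffd (2 * m - 2)) * h (bar m)

/-- `C_{2m} = h_{2m-3} h_{\overline{2m+3}}`. -/
def opC (m : ℤ) : R := h (ffd (2 * m - 3)) * h (bar (m + 1))

/-- The product over an even hole, `μ_{2m-1} = h_{2m-3} h_{2m} h_{2m-2} h_{\overline{2m+1}}`. -/
def opMu (m : ℤ) : R :=
  h (ffd (2 * m - 3)) * h (ffd (2 * m)) * h (ffd (2 * m - 2)) * h (bar m)

end Elements

/-- Defining relations of the extended algebra with coupling constants `c`, for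
`h_1, …, h_{2N+1}` and `h_{\overline 1}, …, h_{\overline{2N+1}}`. A generator whose coupling
constant vanishes is absent. -/
inductive Rel (N : ℕ) (c : Vertex → ℂ) : FreeAlgebra ℂ Vertex → FreeAlgebra ℂ Vertex → Prop
  | sq (v : Vertex) : Rel N c (FreeAlgebra.ι ℂ v * FreeAlgebra.ι ℂ v)
      (algebraMap ℂ (FreeAlgebra ℂ Vertex) (c v ^ 2))
  | absent (v : Vertex) : c v = 0 → Rel N c (FreeAlgebra.ι ℂ v) 0
  | anticomm (v w : Vertex) : frustrationGraph.Adj v w →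
      Rel N c (FreeAlgebra.ι ℂ v * FreeAlgebra.ι ℂ w)
        (-(FreeAlgebra.ι ℂ w * FreeAlgebra.ι ℂ v))
  | comm (v w : Vertex) : ¬ frustrationGraph.Adj v w →
      Rel N c (FreeAlgebra.ι ℂ v * FreeAlgebra.ι ℂ w) (FreeAlgebra.ι ℂ w * FreeAlgebra.ι ℂ v)
  | acca (m : ℤ) : 1 < m → m < (N : ℤ) - 1 →
      Rel N c (opA (FreeAlgebra.ι ℂ) m * opC (FreeAlgebra.ι ℂ) (m + 1))
        (opC (FreeAlgebra.ι ℂ) m * opA (FreeAlgebra.ι ℂ) (m + 2))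

/-- The extended free-fermions-in-disguise algebra, by generators and relations. -/
abbrev ExtAlgebra (N : ℕ) (c : Vertex → ℂ) : Type := RingQuot (Rel N c)

/-- The generators `h_j`, `h_{\overline{2k+1}}` of the extended algebra. -/
noncomputable def gen (N : ℕ) (c : Vertex → ℂ) (v : Vertex) : ExtAlgebra N c :=
  RingQuot.mkAlgHom ℂ (Rel N c) (FreeAlgebra.ι ℂ v)

theorem gen_commute (N : ℕ) (c : Vertex → ℂ) {v w : Vertex} (hvw : ¬ frustrationGraph.Adj v w) :
    Commute (gen N c v) (gen N c w) := by
  have := RingQuot.mkAlgHom_rel ℂ (Rel.comm (N := N) (c := c) v w hvw)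
  simpa [gen, Commute, SemiconjBy] using this

open Classical in
/-- The independent sets of order `k` of `G_M`. -/
noncomputable def indepSets (M : ℤ) (k : ℕ) : Finset (Finset Vertex) :=
  ((vertexSet M).powersetCard k).filter fun S => frustrationGraph.IsIndepSet (S : Set Vertex)

open Classical in
theorem gen_pairwise_commute (N : ℕ) (c : Vertex → ℂ) {M : ℤ} {k : ℕ} {S : Finset Vertex}
    (hS : S ∈ indepSets M k) :
    (S : Set Vertex).Pairwise (Function.onFun Commute (gen N c)) := by
  intro v hv w hw hne
  exact gen_commute N c ((Finset.mem_filter.mp hS).2 hv hw hne)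

/-- The charge `Q_M^{(k)}`: the sum over independent sets of order `k` of `G_M` of the products of
the (mutually commuting) generators in the set. -/
noncomputable def charge (N : ℕ) (c : Vertex → ℂ) (M : ℤ) (k : ℕ) : ExtAlgebra N c :=
  ∑ S ∈ (indepSets M k).attach, S.1.noncommProd (gen N c) (gen_pairwise_commute N c S.2)

/-- The transfer matrix `T_M(u) = ∑_k (-u)^k Q_M^{(k)}`; there are no independent sets of order
larger than the number of vertices. -/
noncomputable def transfer (N : ℕ) (c : Vertex → ℂ) (M : ℤ) (u : ℂ) : ExtAlgebra N c :=
  ∑ k ∈ Finset.range ((vertexSet M).card + 1), (-u) ^ k • charge N c M k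

/-- `S_M`: the independence number of the frustration graph of the generators that are present,
i.e. of the labels in `V_M` with nonzero coupling constant. -/
noncomputable def indepNumber (c : Vertex → ℂ) (M : ℤ) : ℕ :=
  (frustrationGraph.induce {v | v ∈ vertexSet M ∧ c v ≠ 0}).indepNum

/-- The scalar `b_{2m-1}² + b_{2m}² + \bar b_{2m+1}²`. -/
def scalarS (c : Vertex → ℂ) (m : ℤ) : ℂ :=
  c (ffd (2 * m - 1)) ^ 2 + c (ffd (2 * m)) ^ 2 + c (bar m) ^ 2

/-- The scalar `(b_{2m-3} b_{2m} + ε_m b_{2m-2} \bar b_{2m+1})²`. -/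
def scalarA (c : Vertex → ℂ) (ε : ℤ → ℤˣ) (m : ℤ) : ℂ :=
  (c (ffd (2 * m - 3)) * c (ffd (2 * m))
    + ((ε m : ℤ) : ℂ) * (c (ffd (2 * m - 2)) * c (bar m))) ^ 2

/-- The scalar `b_{2m-5}² \bar b_{2m+1}²`. -/
def scalarC (c : Vertex → ℂ) (m : ℤ) : ℂ := c (ffd (2 * m - 5)) ^ 2 * c (bar m) ^ 2

/-- The scalar `b_{2m-3} b_{2m} b_{2m-2} \bar b_{2m+1}`. -/
def scalarMu (c : Vertex → ℂ) (m : ℤ) : ℂ :=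
  c (ffd (2 * m - 3)) * c (ffd (2 * m)) * c (ffd (2 * m - 2)) * c (bar m)

end ExtendedFFD

/-!
With `t_m = T_{2m}(u)` and `b_m = T_{2m}(-u)`, deleting the last vertices of the frustration graph
gives (`IsFrustrated.indepSum_vertexSet_even`), for all integers `m`,
`t_m = t_{m-1} - u S_{2m} t_{m-2} + u² A_{2m-1} t_{m-3} + u² C_{2m-2} t_{m-4}`,
and `b_m` satisfies the same recursion with `-S` in place of `S`. The coefficients form a closed
system under exchange: `S_{2m} S_{2m-2} + S_{2m-2} S_{2m} = 2 A_{2m-1}`,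
`S_{2m} S_{2m-4} - S_{2m-4} S_{2m} = -2 C_{2m-2}`, the other `S`'s commute, and `A_{2m-1}`,
`C_{2m-2}` each commute or anticommute with every generator (`exchangeSign_pair` is the reason for
`A`). The squares of `S` and `C` are scalars, and that of `A` is a scalar once the even-hole
product `μ` is one. `TransferSystem` collects these relations; the parameter `u` is absorbed into
the generators.

These relations alone imply the inversion relation (`inversion`). The induction proves together
* `t_m b_m = p_m`,
* `t_m b_{m-1} + t_{m-1} b_m = 2 p_{m-1}`,
* `t_m b_{m-2} + t_{m-2} b_m = 2 p_{m-2} + 2 u² A_{2m-1} t_{m-3} b_{m-2}`,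

where each follows from instances at smaller indices by moving `S`, `A`, `C` through the `t`'s. For
odd index, `h_{2m-1}` commutes with `t_{m-2}` and the second relation suffices (`odd_step`).

The degree of `P_M` is read off from the coefficient of `u^{2 S_M}` in `T_M(u) T_M(-u)`, which is
`±(Q_M^{(S_M)})²` (`natDegree_of_inversion`). The independence number is bounded above by deleting
vertices (`card_indepSet_bound`) and below by explicit independent sets. For real couplings the
coefficients of `P_M` alternate in sign (`alternatingCoeffs_evenPoly`): the negative `C` term of the
recursion is compensated by the term `\bar b_{2m+1}²` of `S_{2m}²`. Hence nothing cancels, and the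
degree can be followed through the recursion (`coeff_evenPoly_ne_zero`).
-/

/-! ### The four-term recursion and its exchange relations -/

namespace ExtendedFFD

/-- A sequence `t` with the four-term recursion of the transfer matrices `T_{2m}(u)`, written with
`u` absorbed into the coefficients, together with all exchange relations between the coefficients.
The index of `C` is shifted so that `C m` is the commutator of `S m` and `S (m - 2)`: it stands for
`C_{2m-2}`. The recursion is required for every integer `m`, with `t = 1` below zero. -/
structure TransferSystem {R : Type*} [Ring R] (S A C t : ℤ → R) : Prop where
  neg (m : ℤ) : m < 0 → t m = 1
  step (m : ℤ) : t m = t (m - 1) - S m * t (m - 2) + A m * t (m - 3) + C m * t (m - 4)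
  A_neg (m : ℤ) : m < 0 → A m = 0
  SS1 (m : ℤ) : S m * S (m - 1) = -(S (m - 1) * S m) + 2 * A m
  SS2 (m : ℤ) : S m * S (m - 2) = S (m - 2) * S m - 2 * C m
  SA0 (m : ℤ) : S m * A m = A m * S m
  SC0 (m : ℤ) : S m * C m = -(C m * S m)
  AC0 (m : ℤ) : A m * C m = -(C m * A m)
  SA1 (m : ℤ) : S m * A (m - 1) = -(A (m - 1) * S m)
  SC1 (m : ℤ) : S m * C (m - 1) = -(C (m - 1) * S m)
  SA2 (m : ℤ) : S m * A (m - 2) = A (m - 2) * S m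
  SC2 (m : ℤ) : S m * C (m - 2) = C (m - 2) * S m
  AS1 (m : ℤ) : A m * S (m - 1) = S (m - 1) * A m
  AA1 (m : ℤ) : A m * A (m - 1) = -(A (m - 1) * A m)
  AC1 (m : ℤ) : A m * C (m - 1) = C (m - 1) * A m
  AS2 (m : ℤ) : A m * S (m - 2) = -(S (m - 2) * A m)
  AA2 (m : ℤ) : A m * A (m - 2) = -(A (m - 2) * A m)
  AC2 (m : ℤ) : A m * C (m - 2) = -(C (m - 2) * A m)
  CS1 (m : ℤ) : C m * S (m - 1) = S (m - 1) * C m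
  CA1 (m : ℤ) : C m * A (m - 1) = -(A (m - 1) * C m)
  CC1 (m : ℤ) : C m * C (m - 1) = -(C (m - 1) * C m)
  CS2 (m : ℤ) : C m * S (m - 2) = -(S (m - 2) * C m)
  CA2 (m : ℤ) : C m * A (m - 2) = A (m - 2) * C m
  CC2 (m : ℤ) : C m * C (m - 2) = -(C (m - 2) * C m)
  CS3 (m : ℤ) : C m * S (m - 3) = -(S (m - 3) * C m)
  CA3 (m : ℤ) : C m * A (m - 3) = -(A (m - 3) * C m)
  CC3 (m : ℤ) : C m * C (m - 3) = -(C (m - 3) * C m)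
  SS_far (m k : ℤ) : k ≤ m - 3 → Commute (S m) (S k)
  SA_far (m k : ℤ) : k ≤ m - 3 → Commute (S m) (A k)
  SC_far (m k : ℤ) : k ≤ m - 3 → Commute (S m) (C k)
  AS_far (m k : ℤ) : k ≤ m - 3 → Commute (A m) (S k)
  AA_far (m k : ℤ) : k ≤ m - 3 → Commute (A m) (A k)
  AC_far (m k : ℤ) : k ≤ m - 3 → Commute (A m) (C k)
  CS_far (m k : ℤ) : k ≤ m - 4 → Commute (C m) (S k)
  CA_far (m k : ℤ) : k ≤ m - 4 → Commute (C m) (A k)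
  CC_far (m k : ℤ) : k ≤ m - 4 → Commute (C m) (C k)

namespace TransferSystem

variable {R : Type*} [Ring R] {S A C t : ℤ → R}

theorem commute_of_forall_le (H : TransferSystem S A C t) {x : R} {j : ℤ}
    (hS : ∀ k ≤ j, Commute x (S k)) (hA : ∀ k ≤ j, Commute x (A k))
    (hC : ∀ k ≤ j, Commute x (C k)) : Commute x (t j) := by
  suffices h : ∀ (n : ℕ) (k : ℤ), k < n → k ≤ j → Commute x (t k) from
    h (j.toNat + 1) j (by have := Int.self_le_toNat j; push_cast; omega) le_rfl
  intro n
  induction n with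
  | zero =>
    intro k hk _
    rw [H.neg k (by simpa using hk)]
    exact Commute.one_right x
  | succ n ih =>
    intro k hk hkj
    push_cast at hk
    rw [H.step k]
    exact (((ih _ (by omega) (by omega)).sub_right
      ((hS k hkj).mul_right (ih _ (by omega) (by omega)))).add_right
      ((hA k hkj).mul_right (ih _ (by omega) (by omega)))).add_right
      ((hC k hkj).mul_right (ih _ (by omega) (by omega)))

theorem S_comm (H : TransferSystem S A C t) {m k : ℤ} (h : k ≤ m - 3) :
    S m * t k = t k * S m :=
  H.commute_of_forall_le (fun i hi => H.SS_far m i (hi.trans h))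
    (fun i hi => H.SA_far m i (hi.trans h)) (fun i hi => H.SC_far m i (hi.trans h))

theorem A_comm (H : TransferSystem S A C t) {m k : ℤ} (h : k ≤ m - 3) :
    A m * t k = t k * A m :=
  H.commute_of_forall_le (fun i hi => H.AS_far m i (hi.trans h))
    (fun i hi => H.AA_far m i (hi.trans h)) (fun i hi => H.AC_far m i (hi.trans h))

theorem C_comm (H : TransferSystem S A C t) {m k : ℤ} (h : k ≤ m - 4) :
    C m * t k = t k * C m :=
  H.commute_of_forall_le (fun i hi => H.CS_far m i (hi.trans h))
    (fun i hi => H.CA_far m i (hi.trans h)) (fun i hi => H.CC_far m i (hi.trans h))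

theorem step1 (H : TransferSystem S A C t) (m : ℤ) :
    t (m - 1) = t (m - 2) - S (m - 1) * t (m - 3) + A (m - 1) * t (m - 4)
      + C (m - 1) * t (m - 5) := by
  have := H.step (m - 1)
  rwa [sub_sub, sub_sub, sub_sub, sub_sub] at this

theorem step2 (H : TransferSystem S A C t) (m : ℤ) :
    t (m - 2) = t (m - 3) - S (m - 2) * t (m - 4) + A (m - 2) * t (m - 5)
      + C (m - 2) * t (m - 6) := by
  have := H.step (m - 2)
  rwa [sub_sub, sub_sub, sub_sub, sub_sub] at this

theorem step3 (H : TransferSystem S A C t) (m : ℤ) :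
    t (m - 3) = t (m - 4) - S (m - 3) * t (m - 5) + A (m - 3) * t (m - 6)
      + C (m - 3) * t (m - 7) := by
  have := H.step (m - 3)
  rwa [sub_sub, sub_sub, sub_sub, sub_sub] at this

/-- Moving `S m` through `t (m - 2)`: only its commutator with `S (m - 2)` contributes. -/
theorem S_mul_two (H : TransferSystem S A C t) (m : ℤ) :
    S m * t (m - 2) = t (m - 2) * S m + 2 * C m * t (m - 4) := by
  have e3 : S m * t (m - 3) = t (m - 3) * S m := H.S_comm (by omega)
  have e4 : S m * t (m - 4) = t (m - 4) * S m := H.S_comm (by omega)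
  have e5 : S m * t (m - 5) = t (m - 5) * S m := H.S_comm (by omega)
  have e6 : S m * t (m - 6) = t (m - 6) * S m := H.S_comm (by omega)
  rw [H.step2 m]
  linear_combination (norm := noncomm_ring) e3 - H.SS2 m * t (m - 4) - S (m - 2) * e4
    + H.SA2 m * t (m - 5) + A (m - 2) * e5 + H.SC2 m * t (m - 6) + C (m - 2) * e6

/-- Moving `A m` through `t (m - 2)`: `t (m - 3)` commutes with `A m` and the increment
`t (m - 2) - t (m - 3)` anticommutes with it. -/
theorem A_mul_two (H : TransferSystem S A C t) (m : ℤ) :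
    A m * t (m - 2) = (2 * t (m - 3) - t (m - 2)) * A m := by
  have e3 : A m * t (m - 3) = t (m - 3) * A m := H.A_comm (by omega)
  have e4 : A m * t (m - 4) = t (m - 4) * A m := H.A_comm (by omega)
  have e5 : A m * t (m - 5) = t (m - 5) * A m := H.A_comm (by omega)
  have e6 : A m * t (m - 6) = t (m - 6) * A m := H.A_comm (by omega)
  rw [H.step2 m]
  linear_combination (norm := noncomm_ring) e3 - H.AS2 m * t (m - 4) + S (m - 2) * e4
    + H.AA2 m * t (m - 5) - A (m - 2) * e5 + H.AC2 m * t (m - 6) - C (m - 2) * e6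

/-- Moving `C m` through `t (m - 3)`: `t (m - 4)` commutes with `C m` and the increment
`t (m - 3) - t (m - 4)` anticommutes with it. -/
theorem C_mul_three (H : TransferSystem S A C t) (m : ℤ) :
    C m * t (m - 3) = (2 * t (m - 4) - t (m - 3)) * C m := by
  have e4 : C m * t (m - 4) = t (m - 4) * C m := H.C_comm (by omega)
  have e5 : C m * t (m - 5) = t (m - 5) * C m := H.C_comm (by omega)
  have e6 : C m * t (m - 6) = t (m - 6) * C m := H.C_comm (by omega)
  have e7 : C m * t (m - 7) = t (m - 7) * C m := H.C_comm (by omega)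
  rw [H.step3 m]
  linear_combination (norm := noncomm_ring) e4 - H.CS3 m * t (m - 5) + S (m - 3) * e5
    + H.CA3 m * t (m - 6) - A (m - 3) * e6 + H.CC3 m * t (m - 7) - C (m - 3) * e7

/-- The recursion with the coefficients on the right. The sign of `C` changes because `C m` reverses
to `-C m`. -/
theorem step_right (H : TransferSystem S A C t) (m : ℤ) :
    t m = t (m - 1) - t (m - 2) * S m + t (m - 3) * A m - t (m - 4) * C m := by
  have e3 : A m * t (m - 3) = t (m - 3) * A m := H.A_comm (by omega)
  have e4 : C m * t (m - 4) = t (m - 4) * C m := H.C_comm (by omega)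
  linear_combination (norm := noncomm_ring) H.step m - H.S_mul_two m + e3 - e4

/-- Moving `S m` through `t (m - 1)`: the increment `t (m - 1) - t (m - 2)` is odd under exchange
with `S m`, up to the corrections from the anticommutator and the commutator of the `S`'s. -/
theorem S_mul_one (H : TransferSystem S A C t) (m : ℤ) :
    S m * t (m - 1) = (2 * t (m - 2) - t (m - 1)) * S m - 2 * A m * t (m - 3)
      + 2 * C m * t (m - 4) := by
  have e3 : S m * t (m - 3) = t (m - 3) * S m := H.S_comm (by omega)
  have e4 : S m * t (m - 4) = t (m - 4) * S m := H.S_comm (by omega)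
  have e5 : S m * t (m - 5) = t (m - 5) * S m := H.S_comm (by omega)
  rw [H.step1 m]
  linear_combination (norm := noncomm_ring) H.S_mul_two m - H.SS1 m * t (m - 3) + S (m - 1) * e3
    + H.SA1 m * t (m - 4) - A (m - 1) * e4 + H.SC1 m * t (m - 5) - C (m - 1) * e5

theorem A_mul_one (H : TransferSystem S A C t) (m : ℤ) :
    A m * t (m - 1)
      = (t (m - 1) - 2 * t (m - 2) + 2 * t (m - 3) - 2 * A (m - 1) * t (m - 4)) * A m := by
  have e3 : A m * t (m - 3) = t (m - 3) * A m := H.A_comm (by omega)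
  have e4 : A m * t (m - 4) = t (m - 4) * A m := H.A_comm (by omega)
  have e5 : A m * t (m - 5) = t (m - 5) * A m := H.A_comm (by omega)
  rw [H.step1 m]
  linear_combination (norm := noncomm_ring) H.A_mul_two m - H.AS1 m * t (m - 3) - S (m - 1) * e3
    + H.AA1 m * t (m - 4) - A (m - 1) * e4 + H.AC1 m * t (m - 5) + C (m - 1) * e5

theorem mul_A_one (H : TransferSystem S A C t) (m : ℤ) :
    t (m - 1) * A m
      = A m * (t (m - 1) - 2 * t (m - 2) + 2 * t (m - 3) - 2 * A (m - 1) * t (m - 4)) := by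
  have e3 : A m * t (m - 3) = t (m - 3) * A m := H.A_comm (by omega)
  have e4 : A m * t (m - 4) = t (m - 4) * A m := H.A_comm (by omega)
  linear_combination (norm := noncomm_ring) -H.A_mul_one m + 2 * H.A_mul_two m
    - 2 * e3 + 2 * H.AA1 m * t (m - 4) - 2 * A (m - 1) * e4

theorem C_mul_two (H : TransferSystem S A C t) (m : ℤ) :
    C m * t (m - 2) = (2 * t (m - 4) - t (m - 2) + 2 * A (m - 2) * t (m - 5)) * C m := by
  have e4 : C m * t (m - 4) = t (m - 4) * C m := H.C_comm (by omega)
  have e5 : C m * t (m - 5) = t (m - 5) * C m := H.C_comm (by omega)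
  have e6 : C m * t (m - 6) = t (m - 6) * C m := H.C_comm (by omega)
  rw [H.step2 m]
  linear_combination (norm := noncomm_ring) H.C_mul_three m - H.CS2 m * t (m - 4)
    + S (m - 2) * e4 + H.CA2 m * t (m - 5) + A (m - 2) * e5 + H.CC2 m * t (m - 6)
    - C (m - 2) * e6

theorem mul_C_two (H : TransferSystem S A C t) (m : ℤ) :
    t (m - 2) * C m = C m * (2 * t (m - 4) - t (m - 2) + 2 * A (m - 2) * t (m - 5)) := by
  have e4 : C m * t (m - 4) = t (m - 4) * C m := H.C_comm (by omega)
  have e5 : C m * t (m - 5) = t (m - 5) * C m := H.C_comm (by omega)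
  linear_combination (norm := noncomm_ring) H.C_mul_two m - 2 * e4
    - 2 * H.CA2 m * t (m - 5) - 2 * A (m - 2) * e5

theorem mul_C_one (H : TransferSystem S A C t) (m : ℤ) :
    t (m - 1) * C m = C m * (2 * t (m - 4) - t (m - 1) + 2 * A (m - 2) * t (m - 5)
      - 2 * S (m - 1) * t (m - 4)) := by
  have e3 := H.C_mul_three m
  have e4 : C m * t (m - 4) = t (m - 4) * C m := H.C_comm (by omega)
  have e5 : C m * t (m - 5) = t (m - 5) * C m := H.C_comm (by omega)
  rw [H.step1 m]
  linear_combination (norm := noncomm_ring) H.mul_C_two m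
    - S (m - 1) * e3 + H.CA1 m * t (m - 4) - A (m - 1) * e4
    + H.CC1 m * t (m - 5) - C (m - 1) * e5
    - H.CS1 m * t (m - 3) + 2 * H.CS1 m * t (m - 4) + 2 * S (m - 1) * e4

end TransferSystem
end ExtendedFFD

/-! ### The inversion relation of the recursion -/

namespace ExtendedFFD

open TransferSystem

variable {R : Type*} [Ring R] {S A C t b p s a d : ℤ → R}

/-- The nearest cross terms `t m * b (m - 1)` and `t (m - 1) * b m` add up to `2 p (m - 1)`,
given the cross relations at smaller indices. -/
theorem cross_one (H : TransferSystem S A C t) (H' : TransferSystem (-S) A C b) (m : ℤ)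
    (p1 : t (m - 1) * b (m - 1) = p (m - 1))
    (p2 : t (m - 2) * b (m - 2) = p (m - 2))
    (p3 : t (m - 3) * b (m - 3) = p (m - 3))
    (p4 : t (m - 4) * b (m - 4) = p (m - 4))
    (p5 : t (m - 5) * b (m - 5) = p (m - 5))
    (q1 : t (m - 1) * b (m - 2) + t (m - 2) * b (m - 1) = 2 * p (m - 2))
    (q3 : t (m - 3) * b (m - 4) + t (m - 4) * b (m - 3) = 2 * p (m - 4))
    (q4 : t (m - 4) * b (m - 5) + t (m - 5) * b (m - 4) = 2 * p (m - 5))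
    (r1 : t (m - 1) * b (m - 3) + t (m - 3) * b (m - 1)
      = 2 * p (m - 3) + 2 * A (m - 1) * (t (m - 4) * b (m - 3)))
    (r2 : t (m - 2) * b (m - 4) + t (m - 4) * b (m - 2)
      = 2 * p (m - 4) + 2 * A (m - 2) * (t (m - 5) * b (m - 4))) :
    t m * b (m - 1) + t (m - 1) * b m = 2 * p (m - 1) := by
  have s1 := H'.S_mul_one m
  have s2 := H.S_mul_two m
  simp only [Pi.neg_apply] at s1
  -- the terms linear in `S m` cancel up to terms in `A m` and `C m`
  have hS : t (m - 1) * b (m - 2) * S m - S m * t (m - 2) * b (m - 1)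
      = - 2 * t (m - 2) * A m * b (m - 3)
        + 2 * t (m - 2) * C m * b (m - 4) - 2 * C m * t (m - 4) * b (m - 1) := by
    linear_combination (norm := noncomm_ring) q1 * S m - s2 * b (m - 1) + t (m - 2) * s1
      - 2 * p2 * S m
  have hA2 : t (m - 2) * A m = A m * (2 * t (m - 3) - t (m - 2)) := by
    have e3 : A m * t (m - 3) = t (m - 3) * A m := H.A_comm (by omega)
    linear_combination (norm := noncomm_ring) H.A_mul_two m - 2 * e3
  have eA : A m * b (m - 3) = b (m - 3) * A m := H'.A_comm (by omega)
  have hA : A m * t (m - 3) * b (m - 1) + t (m - 1) * b (m - 3) * A m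
      - 2 * t (m - 2) * A m * b (m - 3) = 0 := by
    linear_combination (norm := noncomm_ring) A m * r1 + H.mul_A_one m * b (m - 3)
      - t (m - 1) * eA - 2 * hA2 * b (m - 3) - 2 * A m * p3
  have eC : C m * b (m - 4) = b (m - 4) * C m := H'.C_comm (by omega)
  have eS4 : S (m - 1) * t (m - 4) = t (m - 4) * S (m - 1) := H.S_comm (by omega)
  have eA4 : A (m - 1) * t (m - 4) = t (m - 4) * A (m - 1) := H.A_comm (by omega)
  have eC4 : t (m - 4) * C (m - 1) = C (m - 1) * (2 * t (m - 5) - t (m - 4)) := by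
    have e5 : C (m - 1) * t (m - 5) = t (m - 5) * C (m - 1) := H.C_comm (by omega)
    have := H.C_mul_three (m - 1)
    rw [show m - 1 - 3 = m - 4 by ring, show m - 1 - 4 = m - 5 by ring] at this
    linear_combination (norm := noncomm_ring) this - 2 * e5
  have st := H.step1 m
  have sb := H'.step1 m
  simp only [Pi.neg_apply] at sb
  have hC : (t (m - 1) - t (m - 2)) * b (m - 4) - t (m - 4) * (b (m - 1) - b (m - 2))
      + 2 * S (m - 1) * p (m - 4) = 0 := by
    linear_combination (norm := noncomm_ring) st * b (m - 4) - t (m - 4) * sb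
      - S (m - 1) * q3 + eS4 * b (m - 3) + eA4 * b (m - 4) - eC4 * b (m - 5)
      + C (m - 1) * q4 - 2 * C (m - 1) * p5
  have hC' : C m * t (m - 4) * b (m - 1) - t (m - 1) * b (m - 4) * C m
      + 2 * t (m - 2) * C m * b (m - 4) - 2 * C m * t (m - 4) * b (m - 1) = 0 := by
    linear_combination (norm := noncomm_ring) C m * hC - H.mul_C_one m * b (m - 4)
      + t (m - 1) * eC + 2 * H.mul_C_two m * b (m - 4) - C m * r2
      + 2 * C m * S (m - 1) * p4 + 2 * C m * p4
  have st0 := H.step m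
  have sb0 := H'.step_right m
  simp only [Pi.neg_apply] at sb0
  linear_combination (norm := noncomm_ring) st0 * b (m - 1) + t (m - 1) * sb0 + 2 * p1
    + hS + hA + hC'

/-- Unlike the nearest ones, the second-nearest cross terms keep a part that is not central,
proportional to `A m`; this is the form in which the relation reproduces itself. -/
theorem cross_two (H : TransferSystem S A C t) (H' : TransferSystem (-S) A C b) (m : ℤ)
    (p2 : t (m - 2) * b (m - 2) = p (m - 2))
    (p3 : t (m - 3) * b (m - 3) = p (m - 3))
    (p4 : t (m - 4) * b (m - 4) = p (m - 4))
    (hp : ∀ k x, p k * x = x * p k)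
    (q1 : t (m - 1) * b (m - 2) + t (m - 2) * b (m - 1) = 2 * p (m - 2))
    (q2 : t (m - 2) * b (m - 3) + t (m - 3) * b (m - 2) = 2 * p (m - 3))
    (r2 : t (m - 2) * b (m - 4) + t (m - 4) * b (m - 2)
      = 2 * p (m - 4) + 2 * A (m - 2) * (t (m - 5) * b (m - 4))) :
    t m * b (m - 2) + t (m - 2) * b m
      = 2 * p (m - 2) + 2 * A m * (t (m - 3) * b (m - 2)) := by
  have st0 := H.step m
  have sb0 := H'.step_right m
  simp only [Pi.neg_apply] at sb0
  have hA2 : t (m - 2) * A m = A m * (2 * t (m - 3) - t (m - 2)) := by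
    have e3 : A m * t (m - 3) = t (m - 3) * A m := H.A_comm (by omega)
    linear_combination (norm := noncomm_ring) H.A_mul_two m - 2 * e3
  have eA : A m * b (m - 3) = b (m - 3) * A m := H'.A_comm (by omega)
  have eC : C m * b (m - 4) = b (m - 4) * C m := H'.C_comm (by omega)
  linear_combination (norm := noncomm_ring) st0 * b (m - 2) + t (m - 2) * sb0 + q1
    - S m * p2 + p2 * S m - hp (m - 2) (-S m)
    - t (m - 2) * eA + hA2 * b (m - 3) + 2 * A m * p3 - A m * q2
    + t (m - 2) * eC - H.mul_C_two m * b (m - 4) + C m * r2 - 2 * C m * p4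

/-- The inversion relation at `m`. With `D` and `E` the increments of `t` and `b`, the cross relation
reduces `t m * b m` to `p (m - 1) + D * E`. The off-diagonal terms of `D * E` cancel, except that
the `S`-`C` terms leave `-2 d p`, which reverses the sign of the diagonal `C` term. -/
theorem inversion_step (H : TransferSystem S A C t) (H' : TransferSystem (-S) A C b) (m : ℤ)
    (hS : S m * S m = s m) (hA : A m * A m = a m) (hC : C m * C m = -d m)
    (hp : ∀ k x, p k * x = x * p k)
    (p0 : p m = p (m - 1) - s m * p (m - 2) + a m * p (m - 3) - d m * p (m - 4))
    (p1 : t (m - 1) * b (m - 1) = p (m - 1))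
    (p2 : t (m - 2) * b (m - 2) = p (m - 2))
    (p3 : t (m - 3) * b (m - 3) = p (m - 3))
    (p4 : t (m - 4) * b (m - 4) = p (m - 4))
    (q0 : t m * b (m - 1) + t (m - 1) * b m = 2 * p (m - 1))
    (q2 : t (m - 2) * b (m - 3) + t (m - 3) * b (m - 2) = 2 * p (m - 3))
    (q3 : t (m - 3) * b (m - 4) + t (m - 4) * b (m - 3) = 2 * p (m - 4))
    (r2 : t (m - 2) * b (m - 4) + t (m - 4) * b (m - 2)
      = 2 * p (m - 4) + 2 * A (m - 2) * (t (m - 5) * b (m - 4))) :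
    t m * b m = p m := by
  have st0 := H.step m
  have sb0 := H'.step_right m
  simp only [Pi.neg_apply] at sb0
  set D := -(S m * t (m - 2)) + A m * t (m - 3) + C m * t (m - 4) with hD
  set E := b (m - 2) * S m + b (m - 3) * A m - b (m - 4) * C m with hE
  have hDE : t m * b m = p (m - 1) + D * E := by
    have h1 : t m = t (m - 1) + D := by rw [hD, st0]; noncomm_ring
    have h2 : b m = b (m - 1) + E := by rw [hE, sb0]; noncomm_ring
    rw [h1, h2] at q0 ⊢
    linear_combination (norm := noncomm_ring) q0 - p1
  have eA : A m * b (m - 3) = b (m - 3) * A m := H'.A_comm (by omega)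
  have eAt : A m * t (m - 3) = t (m - 3) * A m := H.A_comm (by omega)
  have eC : C m * b (m - 4) = b (m - 4) * C m := H'.C_comm (by omega)
  have eCt : C m * t (m - 4) = t (m - 4) * C m := H.C_comm (by omega)
  have eS : S m * b (m - 3) = b (m - 3) * S m := H'.commute_of_forall_le
    (fun i hi => H.SS_far m i hi |>.neg_right)
    (fun i hi => H.SA_far m i hi) (fun i hi => H.SC_far m i hi)
  have hA2 : t (m - 2) * A m = A m * (2 * t (m - 3) - t (m - 2)) := by
    linear_combination (norm := noncomm_ring) H.A_mul_two m - 2 * eAt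
  have hS2 := H.S_mul_two m
  -- the off-diagonal terms of `D * E`, in pairs: `S` with `A`, `S` with `C`, `A` with `C`
  have h1 : -(S m * t (m - 2) * b (m - 3) * A m) + A m * t (m - 3) * b (m - 2) * S m
      = 2 * A m * C m * (t (m - 4) * b (m - 3)) := by
    have hS2' : S m * b (m - 2) = b (m - 2) * S m - 2 * C m * b (m - 4) := by
      have := H'.S_mul_two m
      simp only [Pi.neg_apply] at this
      linear_combination (norm := noncomm_ring) -this
    linear_combination (norm := noncomm_ring) S m * t (m - 2) * eA - S m * hA2 * b (m - 3)
      - 2 * H.SA0 m * t (m - 3) * b (m - 3) + H.SA0 m * t (m - 2) * b (m - 3)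
      + A m * hS2 * b (m - 3) + A m * t (m - 2) * eS - A m * S m * 2 * p3 + A m * q2 * S m
      + 2 * A m * hp (m - 3) (S m)
  have h2 : S m * t (m - 2) * b (m - 4) * C m + C m * t (m - 4) * b (m - 2) * S m
      = -(2 * d m * p (m - 4)) := by
    have eS4 : S m * b (m - 4) = b (m - 4) * S m := H'.commute_of_forall_le
      (fun i hi => H.SS_far m i (by omega) |>.neg_right)
      (fun i hi => H.SA_far m i (by omega)) (fun i hi => H.SC_far m i (by omega))
    have eS5 : S m * t (m - 5) = t (m - 5) * S m := H.S_comm (by omega)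
    have hX := H.mul_C_two m
    linear_combination (norm := noncomm_ring) -S m * t (m - 2) * eC + S m * hX * b (m - 4)
      + H.SC0 m * (2 * t (m - 4) - t (m - 2) + 2 * A (m - 2) * t (m - 5)) * b (m - 4)
      - 2 * C m * S m * p4 - 2 * C m * H.SA2 m * t (m - 5) * b (m - 4)
      - 2 * C m * A (m - 2) * eS5 * b (m - 4) - 2 * C m * A (m - 2) * t (m - 5) * eS4
      + C m * hS2 * b (m - 4) + C m * t (m - 2) * eS4
      + C m * r2 * S m + 2 * C m * hp (m - 4) (S m) + 2 * C m * C m * p4 + 2 * hC * p (m - 4)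
  have h3 : -(A m * t (m - 3) * b (m - 4) * C m) + C m * t (m - 4) * b (m - 3) * A m
      = -(2 * A m * C m * (t (m - 4) * b (m - 3))) := by
    have hX : t (m - 3) * C m = C m * (2 * t (m - 4) - t (m - 3)) := by
      linear_combination (norm := noncomm_ring) H.C_mul_three m - 2 * eCt
    have eA4 : A m * t (m - 4) = t (m - 4) * A m := H.A_comm (by omega)
    linear_combination (norm := noncomm_ring) A m * t (m - 3) * eC - A m * hX * b (m - 4)
      - C m * t (m - 4) * eA - C m * eA4 * b (m - 3) + H.AC0 m * t (m - 4) * b (m - 3)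
      - 2 * A m * C m * p4 + A m * C m * q3
  rw [hDE, p0, hD, hE]
  linear_combination (norm := noncomm_ring) h1 + h2 + h3 - S m * p2 * S m + A m * p3 * A m
    - C m * p4 * C m + hp (m - 2) (S m) * S m - hp (m - 2) (S m * S m) - hS * p (m - 2)
    - hp (m - 3) (A m) * A m + hp (m - 3) (A m * A m) + hA * p (m - 3)
    + hp (m - 4) (C m) * C m - hp (m - 4) (C m * C m) - hC * p (m - 4)


/-- The inversion relation, by a joint strong induction with the two cross relations. -/
theorem inversion (H : TransferSystem S A C t) (H' : TransferSystem (-S) A C b)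
    (hS : ∀ m, S m * S m = s m) (hA : ∀ m, A m * A m = a m) (hC : ∀ m, C m * C m = -d m)
    (hp : ∀ k x, p k * x = x * p k) (hp_neg : ∀ k < 0, p k = 1)
    (p0 : ∀ m, p m = p (m - 1) - s m * p (m - 2) + a m * p (m - 3) - d m * p (m - 4)) (m : ℤ) :
    t m * b m = p m ∧ t m * b (m - 1) + t (m - 1) * b m = 2 * p (m - 1) ∧
      t m * b (m - 2) + t (m - 2) * b m
        = 2 * p (m - 2) + 2 * A m * (t (m - 3) * b (m - 2)) := by
  suffices h : ∀ (n : ℕ) (k : ℤ), k < n → t k * b k = p k ∧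
      t k * b (k - 1) + t (k - 1) * b k = 2 * p (k - 1) ∧
      t k * b (k - 2) + t (k - 2) * b k
        = 2 * p (k - 2) + 2 * A k * (t (k - 3) * b (k - 2)) from
    h (m.toNat + 1) m (by have := Int.self_le_toNat m; push_cast; omega)
  intro n
  induction n with
  | zero =>
    intro k hk
    have hk : k < 0 := by simpa using hk
    rw [H.neg k hk, H.neg (k - 1) (by omega), H.neg (k - 2) (by omega), H'.neg k hk,
      H'.neg (k - 1) (by omega), H'.neg (k - 2) (by omega), hp_neg k hk,
      hp_neg (k - 1) (by omega), hp_neg (k - 2) (by omega), H.A_neg k hk]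
    refine ⟨by simp, by norm_num, by norm_num⟩
  | succ n ih =>
    intro k hk
    push_cast at hk
    obtain ⟨p1, q1, r1⟩ := ih (k - 1) (by omega)
    obtain ⟨p2, q2, r2⟩ := ih (k - 2) (by omega)
    obtain ⟨p3, q3, -⟩ := ih (k - 3) (by omega)
    obtain ⟨p4, q4, -⟩ := ih (k - 4) (by omega)
    obtain ⟨p5, -, -⟩ := ih (k - 5) (by omega)
    simp only [sub_sub] at q1 q2 q3 q4 r1 r2
    norm_num at q1 q2 q3 q4 r1 r2
    have e1 := cross_one H H' k p1 p2 p3 p4 p5 q1 q3 q4 r1 r2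
    exact ⟨inversion_step H H' k (hS k) (hA k) (hC k) hp (p0 k) p1 p2 p3 p4 e1 q2 q3 r2, e1,
      cross_two H H' k p2 p3 p4 hp q1 q2 r2⟩

end ExtendedFFD

/-! ### Exchange signs and the squares of `μ`, `S`, `C`, `A` -/

namespace ExtendedFFD

open Vertex

/-- The relations that the generators `h` have among themselves, in any complex algebra: squares given
by the coupling constants `c`, and anticommutation or commutation according to the frustration
graph. The relation `A C = C A` of the extended algebra is left out. -/
structure IsFrustrated {A : Type*} [Ring A] [Algebra ℂ A] (c : Vertex → ℂ) (h : Vertex → A) :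
    Prop where
  sq (v : Vertex) : h v * h v = algebraMap ℂ A (c v ^ 2)
  absent (v : Vertex) : c v = 0 → h v = 0
  anti (v w : Vertex) : frustrationGraph.Adj v w → h v * h w = -(h w * h v)
  comm (v w : Vertex) : ¬ frustrationGraph.Adj v w → h v * h w = h w * h v

@[simp]
theorem adj_ffd_ffd (i j : ℤ) : frustrationGraph.Adj (ffd i) (ffd j) ↔ i ≠ j ∧ |i - j| ≤ 2 :=
  Iff.rfl

@[simp]
theorem adj_bar_bar (i j : ℤ) : frustrationGraph.Adj (bar i) (bar j) ↔ |i - j| = 1 :=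
  Iff.rfl

@[simp]
theorem adj_ffd_bar (i k : ℤ) : frustrationGraph.Adj (ffd i) (bar k) ↔
    i = 2 * k - 5 ∨ i = 2 * k - 3 ∨ i = 2 * k - 1 ∨ i = 2 * k + 1 ∨ i = 2 * k ∨ i = 2 * k + 2 :=
  Iff.rfl

@[simp]
theorem adj_bar_ffd (i k : ℤ) : frustrationGraph.Adj (bar k) (ffd i) ↔
    i = 2 * k - 5 ∨ i = 2 * k - 3 ∨ i = 2 * k - 1 ∨ i = 2 * k + 1 ∨ i = 2 * k ∨ i = 2 * k + 2 :=
  Iff.rfl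

open Classical in
/-- The sign picked up when the generators labelled `v` and `w` are exchanged. -/
noncomputable def exchangeSign (v w : Vertex) : ℤ := if frustrationGraph.Adj v w then -1 else 1

theorem exchangeSign_ffd_ffd (i j : ℤ) :
    exchangeSign (ffd i) (ffd j) = if i ≠ j ∧ i ≤ j + 2 ∧ j ≤ i + 2 then -1 else 1 := by
  unfold exchangeSign
  congr 1
  rw [adj_ffd_ffd, abs_le, eq_iff_iff]
  omega

theorem exchangeSign_bar_bar (i j : ℤ) :
    exchangeSign (bar i) (bar j) = if i = j + 1 ∨ j = i + 1 then -1 else 1 := by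
  unfold exchangeSign
  congr 1
  rw [adj_bar_bar, abs_eq (by norm_num), eq_iff_iff]
  omega

theorem exchangeSign_ffd_bar (i k : ℤ) :
    exchangeSign (ffd i) (bar k) = if i = 2 * k - 5 ∨ i = 2 * k - 3 ∨ i = 2 * k - 1 ∨
      i = 2 * k + 1 ∨ i = 2 * k ∨ i = 2 * k + 2 then -1 else 1 := by
  unfold exchangeSign
  congr 1

theorem exchangeSign_bar_ffd (i k : ℤ) :
    exchangeSign (bar k) (ffd i) = if i = 2 * k - 5 ∨ i = 2 * k - 3 ∨ i = 2 * k - 1 ∨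
      i = 2 * k + 1 ∨ i = 2 * k ∨ i = 2 * k + 2 then -1 else 1 := by
  unfold exchangeSign
  congr 1

/-- Both terms of `A_{2m-1}` have the same exchange sign with every generator. This makes the
even-hole product central and lets `A_{2m-1}` commute or anticommute with each generator. -/
theorem exchangeSign_pair (m : ℤ) (v : Vertex) :
    exchangeSign (ffd (2 * m - 2)) v * exchangeSign (bar m) v
      = exchangeSign (ffd (2 * m)) v * exchangeSign (ffd (2 * m - 3)) v := by
  rcases v with j | k
  · simp only [exchangeSign_ffd_ffd, exchangeSign_bar_ffd]
    split_ifs <;> first | rfl | omega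
  · simp only [exchangeSign_ffd_bar, exchangeSign_bar_bar]
    split_ifs <;> first | rfl | omega

namespace IsFrustrated

variable {A : Type*} [Ring A] [Algebra ℂ A] {c : Vertex → ℂ} {h : Vertex → A}

theorem exchange (H : IsFrustrated c h) (v w : Vertex) :
    h v * h w = exchangeSign v w • (h w * h v) := by
  unfold exchangeSign
  split_ifs with hvw
  · rw [H.anti v w hvw, neg_one_smul]
  · rw [H.comm v w hvw, one_smul]

theorem exchange_mul (H : IsFrustrated c h) (x y v : Vertex) :
    h x * h y * h v = (exchangeSign x v * exchangeSign y v) • (h v * (h x * h y)) := by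
  rw [mul_assoc, H.exchange y v, mul_smul_comm, ← mul_assoc, H.exchange x v, smul_mul_assoc,
    smul_smul, mul_comm, mul_assoc]

theorem opA_exchange (H : IsFrustrated c h) (m : ℤ) (v : Vertex) :
    opA h m * h v = (exchangeSign (ffd (2 * m)) v * exchangeSign (ffd (2 * m - 3)) v) •
      (h v * opA h m) := by
  unfold opA
  rw [add_mul, mul_add, smul_add, H.exchange_mul, H.exchange_mul, exchangeSign_pair]

theorem opMu_exchange (H : IsFrustrated c h) (m : ℤ) (v : Vertex) :
    opMu h m * h v = h v * opMu h m := by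
  have hs : (exchangeSign (ffd (2 * m - 3)) v * exchangeSign (ffd (2 * m)) v) *
      (exchangeSign (ffd (2 * m - 2)) v * exchangeSign (bar m) v) = 1 := by
    rw [exchangeSign_pair]
    unfold exchangeSign
    split_ifs <;> norm_num
  unfold opMu
  rw [mul_assoc (h (ffd (2 * m - 3)) * h (ffd (2 * m))), mul_assoc, H.exchange_mul,
    mul_smul_comm, ← mul_assoc, H.exchange_mul, smul_mul_assoc, smul_smul,
    mul_comm (exchangeSign (ffd (2 * m - 2)) v * _), hs, one_smul, mul_assoc]

theorem opMu_sq (H : IsFrustrated c h) (m : ℤ) :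
    opMu h m * opMu h m = algebraMap ℂ A (scalarMu c m ^ 2) := by
  have e12 : h (ffd (2 * m - 3)) * h (ffd (2 * m)) = h (ffd (2 * m)) * h (ffd (2 * m - 3)) := by
    rw [H.exchange, exchangeSign_ffd_ffd, if_neg (by omega), one_smul]
  have e34 : h (ffd (2 * m - 2)) * h (bar m) = h (bar m) * h (ffd (2 * m - 2)) := by
    rw [H.exchange, exchangeSign_ffd_bar, if_neg (by omega), one_smul]
  have e := H.opMu_exchange m
  have h1 := H.sq (ffd (2 * m - 3))
  have h2 := H.sq (ffd (2 * m))
  have h3 := H.sq (ffd (2 * m - 2))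
  have h4 := H.sq (bar m)
  have hc (x : ℂ) (y : A) : algebraMap ℂ A x * y = y * algebraMap ℂ A x := Algebra.commutes x y
  calc opMu h m * opMu h m
      = h (ffd (2 * m - 3)) * h (ffd (2 * m)) * (h (ffd (2 * m - 2)) * h (bar m) * opMu h m) := by
        unfold opMu; noncomm_ring
    _ = h (ffd (2 * m - 3)) * h (ffd (2 * m)) * (opMu h m * (h (ffd (2 * m - 2)) * h (bar m))) := by
        rw [mul_assoc (h (ffd (2 * m - 2))), ← e, ← mul_assoc (h (ffd (2 * m - 2))), ← e]
        noncomm_ring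
    _ = (h (ffd (2 * m)) * (h (ffd (2 * m - 3)) * h (ffd (2 * m - 3))) * h (ffd (2 * m))) *
        (h (bar m) * (h (ffd (2 * m - 2)) * h (ffd (2 * m - 2))) * h (bar m)) := by
        have : opMu h m = h (ffd (2 * m - 3)) * h (ffd (2 * m)) *
          (h (ffd (2 * m - 2)) * h (bar m)) := by unfold opMu; noncomm_ring
        rw [this]
        nth_rw 1 [e12]
        nth_rw 1 [e34]
        noncomm_ring
    _ = _ := by
        rw [h1, h3, ← hc, ← hc, mul_assoc _ (h (ffd (2 * m))) (h (ffd (2 * m))), h2,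
          mul_assoc _ (h (bar m)) (h (bar m)), h4]
        simp only [← map_mul, scalarMu]
        ring_nf

theorem opS_sq (H : IsFrustrated c h) (m : ℤ) :
    opS h m * opS h m = algebraMap ℂ A (scalarS c m) := by
  have e1 : h (ffd (2 * m - 1)) * h (ffd (2 * m)) = -(h (ffd (2 * m)) * h (ffd (2 * m - 1))) := by
    rw [H.exchange, exchangeSign_ffd_ffd, if_pos (by omega), neg_one_smul]
  have e2 : h (ffd (2 * m - 1)) * h (bar m) = -(h (bar m) * h (ffd (2 * m - 1))) := by
    rw [H.exchange, exchangeSign_ffd_bar, if_pos (by omega), neg_one_smul]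
  have e3 : h (ffd (2 * m)) * h (bar m) = -(h (bar m) * h (ffd (2 * m))) := by
    rw [H.exchange, exchangeSign_ffd_bar, if_pos (by omega), neg_one_smul]
  simp only [opS, scalarS, map_add]
  linear_combination (norm := noncomm_ring) e1 + e2 + e3 + H.sq (ffd (2 * m - 1))
    + H.sq (ffd (2 * m)) + H.sq (bar m)

theorem opC_sq (H : IsFrustrated c h) (m : ℤ) :
    opC h (m - 1) * opC h (m - 1) = -algebraMap ℂ A (scalarC c m) := by
  have e : h (ffd (2 * m - 5)) * h (bar m) = -(h (bar m) * h (ffd (2 * m - 5))) := by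
    rw [H.exchange, exchangeSign_ffd_bar, if_pos (by omega), neg_one_smul]
  have h1 := H.sq (ffd (2 * m - 5))
  have h2 := H.sq (bar m)
  have hC : opC h (m - 1) = h (ffd (2 * m - 5)) * h (bar m) := by
    unfold opC
    rw [show 2 * (m - 1) - 3 = 2 * m - 5 by ring, show m - 1 + 1 = m by ring]
  have hs : algebraMap ℂ A (scalarC c m) = h (ffd (2 * m - 5)) * h (ffd (2 * m - 5)) *
      (h (bar m) * h (bar m)) := by
    rw [h1, h2, ← map_mul, scalarC]
  rw [hC, hs]
  linear_combination (norm := noncomm_ring) h (ffd (2 * m - 5)) * e * h (bar m)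

theorem opA_sq (H : IsFrustrated c h) (m : ℤ) {ε : ℤ → ℤˣ}
    (hμ : opMu h m = algebraMap ℂ A (((ε m : ℤ) : ℂ) * scalarMu c m)) :
    opA h m * opA h m = algebraMap ℂ A (scalarA c ε m) := by
  have e12 : h (ffd (2 * m - 3)) * h (ffd (2 * m)) = h (ffd (2 * m)) * h (ffd (2 * m - 3)) := by
    rw [H.exchange, exchangeSign_ffd_ffd, if_neg (by omega), one_smul]
  have e34 : h (ffd (2 * m - 2)) * h (bar m) = h (bar m) * h (ffd (2 * m - 2)) := by
    rw [H.exchange, exchangeSign_ffd_bar, if_neg (by omega), one_smul]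
  have hx (x : Vertex) : h (ffd (2 * m - 2)) * h (bar m) * h x
      = (exchangeSign (ffd (2 * m)) x * exchangeSign (ffd (2 * m - 3)) x) •
        (h x * (h (ffd (2 * m - 2)) * h (bar m))) := by
    rw [H.exchange_mul, exchangeSign_pair]
  have e1 := hx (ffd (2 * m))
  have e2 := hx (ffd (2 * m - 3))
  simp only [exchangeSign_ffd_ffd] at e1 e2
  rw [if_neg (by omega), if_neg (by omega), one_mul, one_smul] at e1 e2
  have hε : (((ε m : ℤ) : ℂ)) ^ 2 = 1 := by
    rcases Int.units_eq_one_or (ε m) with hm | hm <;> simp [hm]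
  have hs : scalarA c ε m = c (ffd (2 * m)) ^ 2 * c (ffd (2 * m - 3)) ^ 2
      + c (ffd (2 * m - 2)) ^ 2 * c (bar m) ^ 2 + 2 * (((ε m : ℤ) : ℂ) * scalarMu c m) := by
    unfold scalarA scalarMu
    linear_combination (c (ffd (2 * m - 2)) * c (bar m)) ^ 2 * hε
  have h1 := H.sq (ffd (2 * m - 3))
  have h2 := H.sq (ffd (2 * m))
  have h3 := H.sq (ffd (2 * m - 2))
  have h4 := H.sq (bar m)
  rw [hs, map_add, map_add, map_mul, map_mul, map_mul, ← hμ, ← h1, ← h2, ← h3, ← h4, map_ofNat]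
  unfold opA opMu
  linear_combination (norm := noncomm_ring) h (ffd (2 * m)) * e12 * h (ffd (2 * m - 3))
    - h (ffd (2 * m - 2)) * e34 * h (bar m)
    + e1 * h (ffd (2 * m - 3)) + h (ffd (2 * m)) * e2
    - 2 * e12 * h (ffd (2 * m - 2)) * h (bar m)

theorem opC_exchange (H : IsFrustrated c h) (m : ℤ) (v : Vertex) :
    opC h m * h v = (exchangeSign (ffd (2 * m - 3)) v * exchangeSign (bar (m + 1)) v) •
      (h v * opC h m) :=
  H.exchange_mul _ _ _

end IsFrustrated
end ExtendedFFD

/-! ### Sums over independent sets -/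

namespace ExtendedFFD

open Vertex

variable {A : Type*} [Ring A]

open Classical in
/-- The product of the `h v` over `S`, for `h` pairwise commuting on `S`; otherwise the value is `0`.
Only independent sets occur below, where the factors do commute. -/
noncomputable def commProd (h : Vertex → A) (S : Finset Vertex) : A :=
  if hS : (S : Set Vertex).Pairwise (Function.onFun Commute h) then S.noncommProd h hS else 0

open Classical in
/-- The sum over the independent sets contained in `W` of the products of the generators. The transfer
matrix is its value on `vertexSet M` for the rescaled generators `-u h`. -/
noncomputable def indepSum (h : Vertex → A) (W : Finset Vertex) : A :=
  ∑ S ∈ W.powerset.filter (fun S : Finset Vertex =>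
    frustrationGraph.IsIndepSet (S : Set Vertex)), commProd h S

theorem commProd_empty (h : Vertex → A) : commProd h ∅ = 1 := by
  rw [commProd, dif_pos (by simp)]
  exact Finset.noncommProd_empty _ _

section

variable [Algebra ℂ A] {c : Vertex → ℂ} {h : Vertex → A}

theorem IsFrustrated.pairwise (H : IsFrustrated c h) {S : Finset Vertex}
    (hS : frustrationGraph.IsIndepSet (S : Set Vertex)) :
    (S : Set Vertex).Pairwise (Function.onFun Commute h) :=
  fun _ hv _ hw hne => H.comm _ _ (hS hv hw hne)

theorem IsFrustrated.commProd_insert (H : IsFrustrated c h) {S : Finset Vertex} {v : Vertex}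
    (hv : v ∉ S) (hS : frustrationGraph.IsIndepSet ((insert v S : Finset Vertex) : Set Vertex)) :
    commProd h (insert v S) = h v * commProd h S := by
  have hS' : frustrationGraph.IsIndepSet (S : Set Vertex) :=
    hS.mono (by simp)
  rw [commProd, commProd, dif_pos (H.pairwise hS), dif_pos (H.pairwise hS'),
    Finset.noncommProd_insert_of_notMem _ _ _ _ hv]

theorem isIndepSet_insert {S : Finset Vertex} {v : Vertex} (hv : v ∉ S) :
    frustrationGraph.IsIndepSet ((insert v S : Finset Vertex) : Set Vertex) ↔
      frustrationGraph.IsIndepSet (S : Set Vertex) ∧ ∀ w ∈ S, ¬ frustrationGraph.Adj v w := by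
  unfold SimpleGraph.IsIndepSet
  have : Std.Symm fun v w => ¬ frustrationGraph.Adj v w :=
    ⟨fun x y hxy hyx => hxy hyx.symm⟩
  rw [Finset.coe_insert, Set.pairwise_insert_of_symm_of_notMem (by simpa using hv)]
  rfl

open Classical in
theorem IsFrustrated.indepSum_insert (H : IsFrustrated c h) {W : Finset Vertex} {v : Vertex}
    (hv : v ∉ W) : indepSum h (insert v W) =
      indepSum h W + h v * indepSum h (W.filter fun w => ¬ frustrationGraph.Adj v w) := by
  unfold indepSum
  rw [Finset.sum_filter, Finset.sum_powerset_insert hv, ← Finset.sum_filter]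
  congr 1
  have hfilter : W.powerset.filter (fun S : Finset Vertex =>
      frustrationGraph.IsIndepSet ((insert v S : Finset Vertex) : Set Vertex)) =
      (W.filter fun w => ¬ frustrationGraph.Adj v w).powerset.filter
        (fun S : Finset Vertex => frustrationGraph.IsIndepSet (S : Set Vertex)) := by
    ext S
    simp only [Finset.mem_filter, Finset.mem_powerset, Finset.subset_iff]
    constructor
    · rintro ⟨hSW, hS⟩
      obtain ⟨h1, h2⟩ := (isIndepSet_insert fun hvS => hv (hSW hvS)).mp hS
      exact ⟨fun w hw => ⟨hSW hw, h2 w hw⟩, h1⟩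
    · rintro ⟨hSW, h1⟩
      exact ⟨fun w hw => (hSW hw).1, (isIndepSet_insert fun hvS => hv (hSW hvS).1).mpr
        ⟨h1, fun w hw => (hSW hw).2⟩⟩
  rw [← hfilter, Finset.mul_sum, ← Finset.sum_filter]
  refine Finset.sum_congr rfl fun S hS => ?_
  obtain ⟨hSW, hS⟩ := Finset.mem_filter.mp hS
  exact H.commProd_insert (fun hvS => hv (Finset.mem_powerset.mp hSW hvS)) hS

theorem IsFrustrated.commProd_eq_zero (H : IsFrustrated c h) {S : Finset Vertex} {v : Vertex}
    (hS : frustrationGraph.IsIndepSet (S : Set Vertex)) (hv : v ∈ S) (h0 : h v = 0) :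
    commProd h S = 0 := by
  rw [← Finset.insert_erase hv] at hS ⊢
  rw [H.commProd_insert (Finset.notMem_erase v S) hS, h0, zero_mul]

/-- Absent generators do not matter. Therefore the recursions below need no case distinction at the
boundary of the index range. -/
theorem IsFrustrated.indepSum_congr (H : IsFrustrated c h) {W W' : Finset Vertex}
    (hW : ∀ w, h w ≠ 0 → (w ∈ W ↔ w ∈ W')) : indepSum h W = indepSum h W' := by
  classical
  have key (U : Finset Vertex) : indepSum h (U.filter fun w => h w ≠ 0) = indepSum h U := by
    unfold indepSum
    refine Finset.sum_subset
      (Finset.filter_subset_filter _ (Finset.powerset_mono.mpr (Finset.filter_subset _ _))) ?_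
    intro S hS hS'
    simp only [Finset.mem_filter, Finset.mem_powerset, Finset.subset_iff] at hS hS'
    have : ¬ ∀ w ∈ S, h w ≠ 0 := fun hw => hS' ⟨fun w hwS => ⟨hS.1 hwS, hw w hwS⟩, hS.2⟩
    push Not at this
    obtain ⟨v, hv, h0⟩ := this
    exact H.commProd_eq_zero hS.2 hv h0
  rw [← key W, ← key W']
  congr 1
  ext w
  simp only [Finset.mem_filter]
  constructor
  · exact fun hw => ⟨(hW w hw.2).mp hw.1, hw.2⟩
  · exact fun hw => ⟨(hW w hw.2).mpr hw.1, hw.2⟩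

/-- Deletion of the vertex `v`: an independent set either avoids `v`, or consists of `v` and an
independent set of vertices not adjacent to `v`. -/
theorem IsFrustrated.indepSum_delete (H : IsFrustrated c h) {W W' W'' : Finset Vertex} {v : Vertex}
    (hv : v ∉ W) (hW' : ∀ w, h w ≠ 0 → (w ∈ W' ↔ w = v ∨ w ∈ W))
    (hW'' : ∀ w, h w ≠ 0 → (w ∈ W'' ↔ w ∈ W ∧ ¬ frustrationGraph.Adj v w)) :
    indepSum h W' = indepSum h W + h v * indepSum h W'' := by
  classical
  rw [H.indepSum_congr (W := W') (W' := insert v W) (by simpa using hW'), H.indepSum_insert hv,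
    H.indepSum_congr (W := W'') (W' := W.filter fun w => ¬ frustrationGraph.Adj v w)
      (by simpa using hW'')]

theorem IsFrustrated.indepSum_eq_one (H : IsFrustrated c h) {W : Finset Vertex}
    (hW : ∀ w, h w ≠ 0 → w ∉ W) : indepSum h W = 1 := by
  rw [H.indepSum_congr (W' := ∅) (by simpa using hW)]
  simp [indepSum, commProd_empty, Finset.filter_singleton, SimpleGraph.IsIndepSet]

@[simp]
theorem ffd_mem_vertexSet {M j : ℤ} : ffd j ∈ vertexSet M ↔ 1 ≤ j ∧ j ≤ M := by
  simp [vertexSet]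

@[simp]
theorem bar_mem_vertexSet {M k : ℤ} : bar k ∈ vertexSet M ↔ 0 ≤ k ∧ k ≤ M / 2 := by
  simp [vertexSet]

theorem IsFrustrated.indepSum_vertexSet_odd (H : IsFrustrated c h)
    (hf : ∀ j < 1, h (ffd j) = 0) (hb : ∀ k < 0, h (bar k) = 0) (m : ℤ) :
    indepSum h (vertexSet (2 * m - 1)) = indepSum h (vertexSet (2 * m - 2))
      + h (ffd (2 * m - 1)) * indepSum h (vertexSet (2 * m - 4)) := by
  refine H.indepSum_delete (by rw [ffd_mem_vertexSet]; omega) ?_ ?_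
  · rintro (j | k) hw
    · have : 1 ≤ j := by by_contra hj; exact hw (hf j (by omega))
      simp only [ffd_mem_vertexSet, ffd.injEq]
      omega
    · have : 0 ≤ k := by by_contra hj; exact hw (hb k (by omega))
      simp only [bar_mem_vertexSet, reduceCtorEq, false_or]
      omega
  · rintro (j | k) hw
    · have : 1 ≤ j := by by_contra hj; exact hw (hf j (by omega))
      simp only [ffd_mem_vertexSet, adj_ffd_ffd, abs_le]
      omega
    · have : 0 ≤ k := by by_contra hj; exact hw (hb k (by omega))
      simp only [bar_mem_vertexSet, adj_ffd_bar]
      omega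

open Classical in
/-- The four-term recursion. The vertices of the clique `2m-1`, `2m`, `\overline{2m+1}` are deleted
one after the other; the vertices left beside `\overline{2m+1}` are brought back to the sets
`vertexSet` by deleting `2m-2` and by restoring `2m-5`. -/
theorem IsFrustrated.indepSum_vertexSet_even (H : IsFrustrated c h)
    (hf : ∀ j < 1, h (ffd j) = 0) (hb : ∀ k < 0, h (bar k) = 0) (m : ℤ) :
    indepSum h (vertexSet (2 * m)) = indepSum h (vertexSet (2 * m - 2))
      + opS h m * indepSum h (vertexSet (2 * m - 4))
      + opA h m * indepSum h (vertexSet (2 * m - 6))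
      + opC h (m - 1) * indepSum h (vertexSet (2 * m - 8)) := by
  have hf' (j : ℤ) (hj : h (ffd j) ≠ 0) : 1 ≤ j := by
    by_contra hj'; exact hj (hf j (by omega))
  have hb' (k : ℤ) (hk : h (bar k) ≠ 0) : 0 ≤ k := by
    by_contra hk'; exact hk (hb k (by omega))
  have e1 : indepSum h (vertexSet (2 * m))
      = indepSum h ((vertexSet (2 * m)).erase (ffd (2 * m - 1)))
        + h (ffd (2 * m - 1)) * indepSum h (vertexSet (2 * m - 4)) := by
    refine H.indepSum_delete (by simp) ?_ ?_ <;> rintro (j | k) hw <;>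
      (first | have := hf' j hw | have := hb' k hw) <;>
      simp [abs_le] <;> omega
  have e2 : indepSum h ((vertexSet (2 * m)).erase (ffd (2 * m - 1)))
      = indepSum h (((vertexSet (2 * m)).erase (ffd (2 * m - 1))).erase (ffd (2 * m)))
        + h (ffd (2 * m)) * indepSum h (vertexSet (2 * m - 3)) := by
    refine H.indepSum_delete (by simp) ?_ ?_ <;> rintro (j | k) hw <;>
      (first | have := hf' j hw | have := hb' k hw) <;>
      simp [abs_le] <;> omega
  have e3 : indepSum h (((vertexSet (2 * m)).erase (ffd (2 * m - 1))).erase (ffd (2 * m)))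
      = indepSum h (vertexSet (2 * m - 2))
        + h (bar m) * indepSum h ((vertexSet (2 * m - 2)).filter fun w => ¬ frustrationGraph.Adj (bar m) w) := by
    refine H.indepSum_delete (by simp; omega) ?_ ?_ <;> rintro (j | k) hw <;>
      (first | have := hf' j hw | have := hb' k hw) <;>
      simp [abs_eq] <;> omega
  have e4 : indepSum h ((vertexSet (2 * m - 2)).filter fun w => ¬ frustrationGraph.Adj (bar m) w)
      = indepSum h ((vertexSet (2 * m - 4)).erase (ffd (2 * m - 5)))
        + h (ffd (2 * m - 2)) * indepSum h (vertexSet (2 * m - 6)) := by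
    refine H.indepSum_delete (by simp; omega) ?_ ?_ <;> rintro (j | k) hw <;>
      (first | have := hf' j hw | have := hb' k hw) <;>
      simp [abs_le, abs_eq] <;> omega
  have e5 : indepSum h (vertexSet (2 * m - 4))
      = indepSum h ((vertexSet (2 * m - 4)).erase (ffd (2 * m - 5)))
        + h (ffd (2 * m - 5)) * indepSum h (vertexSet (2 * m - 8)) := by
    refine H.indepSum_delete (by simp) ?_ ?_ <;> rintro (j | k) hw <;>
      (first | have := hf' j hw | have := hb' k hw) <;>
      simp [abs_le] <;> omega
  have e6 : indepSum h (vertexSet (2 * m - 3)) = indepSum h (vertexSet (2 * m - 4))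
      + h (ffd (2 * m - 3)) * indepSum h (vertexSet (2 * m - 6)) := by
    have := H.indepSum_vertexSet_odd hf hb (m - 1)
    rwa [show 2 * (m - 1) - 1 = 2 * m - 3 by ring, show 2 * (m - 1) - 2 = 2 * m - 4 by ring,
      show 2 * (m - 1) - 4 = 2 * m - 6 by ring] at this
  have c1 : h (bar m) * h (ffd (2 * m - 2)) = h (ffd (2 * m - 2)) * h (bar m) := by
    rw [H.exchange, exchangeSign_bar_ffd, if_neg (by omega), one_smul]
  have c2 : h (bar m) * h (ffd (2 * m - 5)) = -(h (ffd (2 * m - 5)) * h (bar m)) := by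
    rw [H.exchange, exchangeSign_bar_ffd, if_pos (by omega), neg_one_smul]
  have hC : opC h (m - 1) = h (ffd (2 * m - 5)) * h (bar m) := by
    unfold opC
    rw [show 2 * (m - 1) - 3 = 2 * m - 5 by ring, show m - 1 + 1 = m by ring]
  rw [e1, e2, e3, hC]
  unfold opS opA
  linear_combination (norm := noncomm_ring) h (ffd (2 * m)) * e6 + h (bar m) * e4 - h (bar m) * e5
    + c1 * indepSum h (vertexSet (2 * m - 6)) - c2 * indepSum h (vertexSet (2 * m - 8))

end
end ExtendedFFD

/-! ### The transfer matrices satisfy the recursion -/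

namespace ExtendedFFD

open Vertex

variable {A : Type*} [Ring A] {h : Vertex → A}

/-- `x` is exchanged with all three generators of the block `2k-1`, `2k`, `\overline{2k+1}` at the cost
of the common sign `e`. -/
def ExchangesBlock (h : Vertex → A) (x : A) (k e : ℤ) : Prop :=
  x * h (ffd (2 * k - 1)) = e • (h (ffd (2 * k - 1)) * x) ∧
    x * h (ffd (2 * k)) = e • (h (ffd (2 * k)) * x) ∧ x * h (bar k) = e • (h (bar k) * x)

namespace ExchangesBlock

variable {x : A} {k e e' : ℤ}

theorem opS (hx : ExchangesBlock h x k e) :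
    x * ExtendedFFD.opS h k = e • (ExtendedFFD.opS h k * x) := by
  obtain ⟨h1, h2, h3⟩ := hx
  unfold ExtendedFFD.opS
  rw [mul_add, mul_add, h1, h2, h3, add_mul, add_mul, smul_add, smul_add]

theorem mul_pair {y z : A} (hy : x * y = e • (y * x)) (hz : x * z = e' • (z * x)) :
    x * (y * z) = (e * e') • (y * z * x) := by
  rw [← mul_assoc, hy, smul_mul_assoc, mul_assoc, hz, mul_smul_comm, smul_smul, mul_assoc]

theorem opA (hx : ExchangesBlock h x k e) (hx' : ExchangesBlock h x (k - 1) e') :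
    x * ExtendedFFD.opA h k = (e * e') • (ExtendedFFD.opA h k * x) := by
  obtain ⟨-, h2, h3⟩ := hx
  obtain ⟨h1', h2', -⟩ := hx'
  rw [show 2 * (k - 1) - 1 = 2 * k - 3 by ring] at h1'
  rw [show 2 * (k - 1) = 2 * k - 2 by ring] at h2'
  unfold ExtendedFFD.opA
  rw [mul_add, mul_pair h2 h1', mul_pair h2' h3, add_mul, smul_add, mul_comm e']

theorem opC (hx : ExchangesBlock h x k e) (hx' : ExchangesBlock h x (k - 2) e') :
    x * ExtendedFFD.opC h (k - 1) = (e * e') • (ExtendedFFD.opC h (k - 1) * x) := by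
  obtain ⟨-, -, h3⟩ := hx
  obtain ⟨h1', -, -⟩ := hx'
  rw [show 2 * (k - 2) - 1 = 2 * (k - 1) - 3 by ring] at h1'
  rw [← sub_add_cancel k 1] at h3
  unfold ExtendedFFD.opC
  rw [mul_pair h1' h3, mul_comm e']

end ExchangesBlock

namespace IsFrustrated

variable [Algebra ℂ A] {c : Vertex → ℂ}

/-- The exchange sign of `opA m` with the generators of block `k`, as a function of `d = m - k`. -/
def signA (d : ℤ) : ℤ := if d = 2 ∨ d = -1 then -1 else 1

/-- The exchange sign of `opC (m - 1)` with the generators of block `k`, as a function of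
`d = m - k`. -/
def signC (d : ℤ) : ℤ := if d = 3 ∨ d = 2 ∨ d = 0 ∨ d = -1 then -1 else 1

theorem opA_exchangesBlock (H : IsFrustrated c h) (m k : ℤ) :
    ExchangesBlock h (opA h m) k (signA (m - k)) := by
  refine ⟨?_, ?_, ?_⟩ <;> rw [H.opA_exchange] <;> congr 1 <;>
    simp only [exchangeSign_ffd_ffd, exchangeSign_ffd_bar, signA] <;>
    split_ifs <;> first | rfl | omega

theorem opC_exchangesBlock (H : IsFrustrated c h) (m k : ℤ) :
    ExchangesBlock h (opC h (m - 1)) k (signC (m - k)) := by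
  refine ⟨?_, ?_, ?_⟩ <;> rw [H.opC_exchange] <;> congr 1 <;>
    simp only [exchangeSign_ffd_ffd, exchangeSign_ffd_bar, exchangeSign_bar_ffd,
      exchangeSign_bar_bar, signC] <;>
    split_ifs <;> first | rfl | omega

theorem opA_opS (H : IsFrustrated c h) (m k : ℤ) :
    opA h m * opS h k = signA (m - k) • (opS h k * opA h m) :=
  (H.opA_exchangesBlock m k).opS

theorem opA_opA (H : IsFrustrated c h) (m k : ℤ) :
    opA h m * opA h k = (signA (m - k) * signA (m - k + 1)) • (opA h k * opA h m) := by
  have := (H.opA_exchangesBlock m k).opA (H.opA_exchangesBlock m (k - 1))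
  rwa [sub_sub_eq_add_sub, add_sub_right_comm] at this

theorem opA_opC (H : IsFrustrated c h) (m k : ℤ) :
    opA h m * opC h (k - 1)
      = (signA (m - k) * signA (m - k + 2)) • (opC h (k - 1) * opA h m) := by
  have := (H.opA_exchangesBlock m k).opC (H.opA_exchangesBlock m (k - 2))
  rwa [sub_sub_eq_add_sub, add_sub_right_comm] at this

theorem opC_opS (H : IsFrustrated c h) (m k : ℤ) :
    opC h (m - 1) * opS h k = signC (m - k) • (opS h k * opC h (m - 1)) :=
  (H.opC_exchangesBlock m k).opS

theorem opC_opA (H : IsFrustrated c h) (m k : ℤ) :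
    opC h (m - 1) * opA h k
      = (signC (m - k) * signC (m - k + 1)) • (opA h k * opC h (m - 1)) := by
  have := (H.opC_exchangesBlock m k).opA (H.opC_exchangesBlock m (k - 1))
  rwa [sub_sub_eq_add_sub, add_sub_right_comm] at this

theorem opC_opC (H : IsFrustrated c h) (m k : ℤ) :
    opC h (m - 1) * opC h (k - 1)
      = (signC (m - k) * signC (m - k + 2)) • (opC h (k - 1) * opC h (m - 1)) := by
  have := (H.opC_exchangesBlock m k).opC (H.opC_exchangesBlock m (k - 2))
  rwa [sub_sub_eq_add_sub, add_sub_right_comm] at this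

theorem opS_opS_one (H : IsFrustrated c h) (m : ℤ) :
    opS h m * opS h (m - 1) = -(opS h (m - 1) * opS h m) + 2 * opA h m := by
  have e1 := H.exchange (ffd (2 * m - 1)) (ffd (2 * m - 3))
  have e2 := H.exchange (ffd (2 * m - 1)) (ffd (2 * m - 2))
  have e3 := H.exchange (ffd (2 * m - 1)) (bar (m - 1))
  have e4 := H.exchange (ffd (2 * m)) (ffd (2 * m - 3))
  have e5 := H.exchange (ffd (2 * m)) (ffd (2 * m - 2))
  have e6 := H.exchange (ffd (2 * m)) (bar (m - 1))
  have e7 := H.exchange (bar m) (ffd (2 * m - 3))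
  have e8 := H.exchange (bar m) (ffd (2 * m - 2))
  have e9 := H.exchange (bar m) (bar (m - 1))
  simp only [exchangeSign_ffd_ffd, exchangeSign_ffd_bar, exchangeSign_bar_ffd,
    exchangeSign_bar_bar] at e1 e2 e3 e4 e5 e6 e8 e9
  rw [exchangeSign_bar_ffd, if_pos (by omega), neg_one_smul] at e7
  rw [if_pos (by omega), neg_one_smul] at e1 e2 e3 e5 e6 e9
  rw [if_neg (by omega), one_smul] at e4 e8
  unfold opS opA
  rw [show 2 * (m - 1) - 1 = 2 * m - 3 by ring, show 2 * (m - 1) = 2 * m - 2 by ring]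
  linear_combination (norm := noncomm_ring) e1 + e2 + e3 - e4 + e5 + e6 + e7 + e8 + e9

theorem opS_opS_two (H : IsFrustrated c h) (m : ℤ) :
    opS h m * opS h (m - 2) = opS h (m - 2) * opS h m - 2 * opC h (m - 1) := by
  have e1 := H.exchange (ffd (2 * m - 1)) (ffd (2 * m - 5))
  have e2 := H.exchange (ffd (2 * m - 1)) (ffd (2 * m - 4))
  have e3 := H.exchange (ffd (2 * m - 1)) (bar (m - 2))
  have e4 := H.exchange (ffd (2 * m)) (ffd (2 * m - 5))
  have e5 := H.exchange (ffd (2 * m)) (ffd (2 * m - 4))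
  have e6 := H.exchange (ffd (2 * m)) (bar (m - 2))
  have e7 := H.exchange (bar m) (ffd (2 * m - 5))
  have e8 := H.exchange (bar m) (ffd (2 * m - 4))
  have e9 := H.exchange (bar m) (bar (m - 2))
  simp only [exchangeSign_ffd_ffd, exchangeSign_ffd_bar, exchangeSign_bar_ffd,
    exchangeSign_bar_bar] at e1 e2 e3 e4 e5 e6 e8 e9
  rw [exchangeSign_bar_ffd, if_pos (by omega), neg_one_smul] at e7
  rw [if_neg (by omega), one_smul] at e1 e2 e3 e4 e5 e6 e8 e9
  unfold opS opC
  rw [show 2 * (m - 2) - 1 = 2 * m - 5 by ring, show 2 * (m - 2) = 2 * m - 4 by ring,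
    show 2 * (m - 1) - 3 = 2 * m - 5 by ring, sub_add_cancel]
  linear_combination (norm := noncomm_ring) e1 + e2 + e3 + e4 + e5 + e6 + e7 + e8 + e9

theorem opS_opS_far (H : IsFrustrated c h) {m k : ℤ} (hk : k ≤ m - 3) :
    Commute (opS h m) (opS h k) := by
  have hc (v w : Vertex) (hvw : ¬ frustrationGraph.Adj v w) : Commute (h v) (h w) :=
    H.comm v w hvw
  unfold opS
  refine .add_left (.add_left ?_ ?_) ?_ <;> refine .add_right (.add_right ?_ ?_) ?_ <;>
    refine hc _ _ ?_ <;> simp [abs_le, abs_eq] <;> omega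

theorem neg (H : IsFrustrated c h) : IsFrustrated c (-h) where
  sq v := by simpa using H.sq v
  absent v hv := by simpa using H.absent v hv
  anti v w hvw := by simpa using H.anti v w hvw
  comm v w hvw := by simpa using H.comm v w hvw

/-- The parameter `u` can be absorbed into the generators, with the coupling constants rescaled. -/
theorem smul (H : IsFrustrated c h) (u : ℂ) : IsFrustrated (u • c) (u • h) where
  sq v := by
    rw [Pi.smul_apply, Pi.smul_apply, smul_mul_smul_comm, H.sq v, Algebra.smul_def, ← map_mul,
      smul_eq_mul, mul_pow, pow_two u]
  absent v hv := by
    rcases mul_eq_zero.mp hv with hu | hv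
    · simp [hu]
    · simp [H.absent v hv]
  anti v w hvw := by
    simp only [Pi.smul_apply, smul_mul_smul_comm, H.anti v w hvw, smul_neg]
  comm v w hvw := by
    simp only [Pi.smul_apply, smul_mul_smul_comm, H.comm v w hvw]

/-- The transfer matrices of a representation form a `TransferSystem`. -/
theorem transferSystem (H : IsFrustrated c h)
    (hf : ∀ j < 1, h (ffd j) = 0) (hb : ∀ k < 0, h (bar k) = 0) :
    TransferSystem (opS h) (opA h) (fun m => opC h (m - 1))
      (fun m => indepSum (-h) (vertexSet (2 * m))) := by
  have hcomm {x y : A} {e : ℤ} (hxy : x * y = e • (y * x)) (he : e = 1) : x * y = y * x := by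
    rw [hxy, he, one_smul]
  have hanti {x y : A} {e : ℤ} (hxy : x * y = e • (y * x)) (he : e = -1) : x * y = -(y * x) := by
    rw [hxy, he, neg_one_smul]
  have hanti' {x y : A} {e : ℤ} (hxy : x * y = e • (y * x)) (he : e = -1) : y * x = -(x * y) := by
    rw [hxy, he, neg_one_smul, neg_neg]
  have hsA (d : ℤ) : signA d = if d = 2 ∨ d = -1 then -1 else 1 := rfl
  have hsC (d : ℤ) : signC d = if d = 3 ∨ d = 2 ∨ d = 0 ∨ d = -1 then -1 else 1 := rfl
  refine
  { neg := ?_, step := ?_, A_neg := ?_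
    SS1 := H.opS_opS_one
    SS2 := H.opS_opS_two
    SA0 := fun m => (hcomm (H.opA_opS m m) (by simp [hsA])).symm
    SC0 := fun m => hanti' (H.opC_opS m m) (by simp [hsC])
    AC0 := fun m => hanti (H.opA_opC m m) (by simp [hsA])
    SA1 := fun m => hanti' (H.opA_opS (m - 1) m) (by simp [hsA])
    SC1 := fun m => hanti' (H.opC_opS (m - 1) m) (by simp [hsC])
    SA2 := fun m => (hcomm (H.opA_opS (m - 2) m) (by simp [hsA])).symm
    SC2 := fun m => (hcomm (H.opC_opS (m - 2) m) (by simp [hsC])).symm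
    AS1 := fun m => hcomm (H.opA_opS m (m - 1)) (by simp [hsA])
    AA1 := fun m => hanti (H.opA_opA m (m - 1)) (by simp [hsA])
    AC1 := fun m => hcomm (H.opA_opC m (m - 1)) (by simp [hsA])
    AS2 := fun m => hanti (H.opA_opS m (m - 2)) (by simp [hsA])
    AA2 := fun m => hanti (H.opA_opA m (m - 2)) (by simp [hsA])
    AC2 := fun m => hanti (H.opA_opC m (m - 2)) (by simp [hsA])
    CS1 := fun m => hcomm (H.opC_opS m (m - 1)) (by simp [hsC])
    CA1 := fun m => hanti (H.opC_opA m (m - 1)) (by simp [hsC])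
    CC1 := fun m => hanti (H.opC_opC m (m - 1)) (by simp [hsC])
    CS2 := fun m => hanti (H.opC_opS m (m - 2)) (by simp [hsC])
    CA2 := fun m => hcomm (H.opC_opA m (m - 2)) (by simp [hsC])
    CC2 := fun m => hanti (H.opC_opC m (m - 2)) (by simp [hsC])
    CS3 := fun m => hanti (H.opC_opS m (m - 3)) (by simp [hsC])
    CA3 := fun m => hanti (H.opC_opA m (m - 3)) (by simp [hsC])
    CC3 := fun m => hanti (H.opC_opC m (m - 3)) (by simp [hsC])
    SS_far := fun m k hk => H.opS_opS_far hk
    SA_far := fun m k hk => (hcomm (H.opA_opS k m) (by rw [hsA, if_neg]; omega)).symm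
    SC_far := fun m k hk => (hcomm (H.opC_opS k m) (by rw [hsC, if_neg]; omega)).symm
    AS_far := fun m k hk => hcomm (H.opA_opS m k) (by rw [hsA, if_neg]; omega)
    AA_far := fun m k hk => hcomm (H.opA_opA m k)
      (by rw [hsA, hsA, if_neg (by omega), if_neg (by omega), one_mul])
    AC_far := fun m k hk => hcomm (H.opA_opC m k)
      (by rw [hsA, hsA, if_neg (by omega), if_neg (by omega), one_mul])
    CS_far := fun m k hk => hcomm (H.opC_opS m k) (by rw [hsC, if_neg]; omega)
    CA_far := fun m k hk => hcomm (H.opC_opA m k)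
      (by rw [hsC, hsC, if_neg (by omega), if_neg (by omega), one_mul])
    CC_far := fun m k hk => hcomm (H.opC_opC m k)
      (by rw [hsC, hsC, if_neg (by omega), if_neg (by omega), one_mul]) }
  · intro m hm
    refine H.neg.indepSum_eq_one ?_
    rintro (j | k) - <;> simp <;> omega
  · intro m
    have := H.neg.indepSum_vertexSet_even (fun j hj => by simp [hf j hj])
      (fun k hk => by simp [hb k hk]) m
    have hS : opS (-h) m = -opS h m := by simp only [opS, Pi.neg_apply]; abel
    have hA : opA (-h) m = opA h m := by simp [opA]
    have hC : opC (-h) (m - 1) = opC h (m - 1) := by simp [opC]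
    rw [hS, hA, hC] at this
    rw [this, show 2 * (m - 1) = 2 * m - 2 by ring, show 2 * (m - 2) = 2 * m - 4 by ring,
      show 2 * (m - 3) = 2 * m - 6 by ring, show 2 * (m - 4) = 2 * m - 8 by ring, neg_mul,
      ← sub_eq_add_neg]
  · intro m hm
    simp [opA, hf (2 * m) (by omega), hb m hm]

end IsFrustrated
end ExtendedFFD

/-! ### The polynomials `P_M` and the inversion relation -/

namespace ExtendedFFD

open Vertex Polynomial

/-- The inversion relation for the odd transfer matrix `t (m - 1) - x * t (m - 2)`, where `x` stands for
`u h_{2m-1}`: the terms linear in `x` cancel by the nearest cross relation. -/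
theorem odd_step {R : Type*} [Ring R] {S A C t b p : ℤ → R}
    (H : TransferSystem S A C t) (H' : TransferSystem (-S) A C b) (m : ℤ) {x : R}
    (p1 : t (m - 1) * b (m - 1) = p (m - 1)) (p2 : t (m - 2) * b (m - 2) = p (m - 2))
    (q1 : t (m - 1) * b (m - 2) + t (m - 2) * b (m - 1) = 2 * p (m - 2))
    (hS : x * S (m - 1) = -(S (m - 1) * x)) (hA : x * A (m - 1) = -(A (m - 1) * x))
    (hC : x * C (m - 1) = -(C (m - 1) * x)) (hS' : ∀ k ≤ m - 2, Commute x (S k))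
    (hA' : ∀ k ≤ m - 2, Commute x (A k)) (hC' : ∀ k ≤ m - 2, Commute x (C k)) :
    (t (m - 1) - x * t (m - 2)) * (b (m - 1) + x * b (m - 2))
      = p (m - 1) - x * x * p (m - 2) := by
  have hb (k : ℤ) (hk : k ≤ m - 2) : x * b k = b k * x :=
    H'.commute_of_forall_le (fun i hi => (hS' i (by omega)).neg_right)
      (fun i hi => hA' i (by omega)) (fun i hi => hC' i (by omega))
  have h2 : x * t (m - 2) = t (m - 2) * x := H.commute_of_forall_le hS' hA' hC'
  have h1 : x * b (m - 1) = (2 * b (m - 2) - b (m - 1)) * x := by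
    have sb := H'.step1 m
    simp only [Pi.neg_apply] at sb
    rw [sb]
    linear_combination (norm := noncomm_ring) hb (m - 2) le_rfl + hS * b (m - 3)
      - S (m - 1) * hb (m - 3) (by omega) + hA * b (m - 4) - A (m - 1) * hb (m - 4) (by omega)
      + hC * b (m - 5) - C (m - 1) * hb (m - 5) (by omega)
  linear_combination (norm := noncomm_ring) p1 - x * x * p2 + x * h2 * b (m - 2) - h2 * b (m - 1) - t (m - 2) * h1
    + t (m - 1) * hb (m - 2) le_rfl + q1 * x - 2 * p2 * x

variable (c : Vertex → ℂ) (ε : ℤ → ℤˣ)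

/-- The polynomial `P_{2m}` at index `n = m + 4`, so that natural numbers suffice for the four-term
recursion. -/
noncomputable def shiftedEvenPoly : ℕ → ℂ[X]
  | 0 | 1 | 2 | 3 => 1
  | n + 4 => shiftedEvenPoly (n + 3) - C (scalarS c n) * X * shiftedEvenPoly (n + 2)
      + C (scalarA c ε n) * X ^ 2 * shiftedEvenPoly (n + 1)
      - C (scalarC c n) * X ^ 2 * shiftedEvenPoly n

/-- The polynomial `P_{2m}`. -/
noncomputable def evenPoly (m : ℤ) : ℂ[X] := shiftedEvenPoly c ε (m + 4).toNat

/-- The polynomial `P_M`. -/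
noncomputable def inversionPoly (M : ℤ) : ℂ[X] :=
  if Even M then evenPoly c ε (M / 2)
  else evenPoly c ε (M / 2) - C (c (ffd M) ^ 2) * X * evenPoly c ε (M / 2 - 1)

theorem evenPoly_neg {m : ℤ} (hm : m < 0) : evenPoly c ε m = 1 := by
  unfold evenPoly
  have : (m + 4).toNat = 0 ∨ (m + 4).toNat = 1 ∨ (m + 4).toNat = 2 ∨ (m + 4).toNat = 3 := by omega
  rcases this with h | h | h | h <;> rw [h, shiftedEvenPoly]

theorem evenPoly_step {m : ℤ} (hm : 0 ≤ m) : evenPoly c ε m = evenPoly c ε (m - 1)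
    - C (scalarS c m) * X * evenPoly c ε (m - 2) + C (scalarA c ε m) * X ^ 2 * evenPoly c ε (m - 3)
    - C (scalarC c m) * X ^ 2 * evenPoly c ε (m - 4) := by
  obtain ⟨n, rfl⟩ := Int.eq_ofNat_of_zero_le hm
  have h4 : ((n : ℤ) + 4).toNat = n + 4 := by omega
  have h3 : ((n : ℤ) - 1 + 4).toNat = n + 3 := by omega
  have h2 : ((n : ℤ) - 2 + 4).toNat = n + 2 := by omega
  have h1 : ((n : ℤ) - 3 + 4).toNat = n + 1 := by omega
  have h0 : ((n : ℤ) - 4 + 4).toNat = n := by omega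
  simp only [evenPoly, h4, h3, h2, h1, h0]
  rw [shiftedEvenPoly]

theorem inversionPoly_even (m : ℤ) : inversionPoly c ε (2 * m) = evenPoly c ε m := by
  rw [inversionPoly, if_pos (even_two_mul m)]
  congr 1
  omega

theorem inversionPoly_odd (m : ℤ) : inversionPoly c ε (2 * m - 1) = evenPoly c ε (m - 1)
    - C (c (ffd (2 * m - 1)) ^ 2) * X * evenPoly c ε (m - 2) := by
  rw [inversionPoly, if_neg (by rw [Int.not_even_iff_odd]; exact ⟨m - 1, by ring⟩),
    show (2 * m - 1) / 2 = m - 1 by omega, show m - 1 - 1 = m - 2 by ring]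

variable {c ε} {A : Type*} [Ring A] [Algebra ℂ A] {h : Vertex → A}

/-- The inversion relation `T_M(u) T_M(-u) = P_M(u²)` for all `M`. -/
theorem IsFrustrated.inversion (H : IsFrustrated c h)
    (hcf : ∀ j < 1, c (ffd j) = 0) (hcb : ∀ k < 0, c (bar k) = 0)
    (hA : ∀ m, opA h m ^ 2 = algebraMap ℂ A (scalarA c ε m)) (M : ℤ) (u : ℂ) :
    indepSum (-(u • h)) (vertexSet M) * indepSum (u • h) (vertexSet M)
      = algebraMap ℂ A ((inversionPoly c ε M).eval (u ^ 2)) := by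
  have hf (j : ℤ) (hj : j < 1) : h (ffd j) = 0 := H.absent _ (hcf j hj)
  have hb (k : ℤ) (hk : k < 0) : h (bar k) = 0 := H.absent _ (hcb k hk)
  have hf' (j : ℤ) (hj : j < 1) : (u • h) (ffd j) = 0 := by simp [hf j hj]
  have hb' (k : ℤ) (hk : k < 0) : (u • h) (bar k) = 0 := by simp [hb k hk]
  have Hu := H.smul u
  have K := Hu.transferSystem hf' hb'
  have K' := Hu.neg.transferSystem (fun j hj => by simp [hf j hj]) (fun k hk => by simp [hb k hk])
  have eS : opS (-(u • h)) = -opS (u • h) := by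
    funext m; simp only [opS, Pi.neg_apply]; abel
  have eA : opA (-(u • h)) = opA (u • h) := by funext m; simp [opA]
  have eC : (fun m => opC (-(u • h)) (m - 1)) = fun m => opC (u • h) (m - 1) := by
    funext m; simp [opC]
  rw [eS, eA, eC, neg_neg] at K'
  have hA' (m : ℤ) : opA (u • h) m * opA (u • h) m
      = algebraMap ℂ A ((u ^ 2) ^ 2 * scalarA c ε m) := by
    have : opA (u • h) m = u ^ 2 • opA h m := by
      simp [opA, smul_smul, pow_two]
    rw [this, smul_mul_smul_comm, ← pow_two, ← pow_two, hA m, Algebra.smul_def, ← map_mul]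
  have hS' (m : ℤ) : opS (u • h) m * opS (u • h) m
      = algebraMap ℂ A (u ^ 2 * scalarS c m) := by
    rw [Hu.opS_sq]
    congr 1
    simp [scalarS]; ring
  have hC' (m : ℤ) : opC (u • h) (m - 1) * opC (u • h) (m - 1)
      = -algebraMap ℂ A ((u ^ 2) ^ 2 * scalarC c m) := by
    rw [Hu.opC_sq]
    congr 2
    simp [scalarC]; ring
  have hp (k : ℤ) (x : A) : algebraMap ℂ A ((evenPoly c ε k).eval (u ^ 2)) * x
      = x * algebraMap ℂ A ((evenPoly c ε k).eval (u ^ 2)) := Algebra.commutes _ _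
  have main := ExtendedFFD.inversion K K' hS' hA' hC' hp
    (fun k hk => by rw [evenPoly_neg c ε hk, eval_one, map_one]) (fun m => by
      rw [← map_mul, ← map_mul, ← map_mul, ← map_sub, ← map_add, ← map_sub]
      congr 1
      rcases lt_or_ge m 0 with hm | hm
      · rw [evenPoly_neg c ε hm, evenPoly_neg c ε (by omega : m - 1 < 0)]
        have : scalarS c m = 0 ∧ scalarA c ε m = 0 ∧ scalarC c m = 0 := by
          simp [scalarS, scalarA, scalarC, hcb m hm, hcf (2 * m) (by omega),
            hcf (2 * m - 1) (by omega)]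
        simp [this.1, this.2.1, this.2.2]
      · conv_lhs => rw [evenPoly_step c ε hm]
        simp only [eval_sub, eval_add, eval_mul, eval_C, eval_X, eval_pow]
        ring)
  rcases Int.even_or_odd' M with ⟨m, rfl | rfl⟩
  · rw [inversionPoly_even]
    have := (main m).1
    simpa using this
  · obtain ⟨m, rfl⟩ : ∃ k, m = k - 1 := ⟨m + 1, by ring⟩
    rw [show 2 * (m - 1) + 1 = 2 * m - 1 by ring, inversionPoly_odd,
      Hu.neg.indepSum_vertexSet_odd (fun j hj => by simp [hf j hj]) (fun k hk => by simp [hb k hk]),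
      Hu.indepSum_vertexSet_odd hf' hb']
    have e2 := (main (m - 1)).2.1
    rw [show m - 1 - 1 = m - 2 by ring] at e2
    have hblockA (k : ℤ) := (Hu.opA_exchangesBlock k m).1
    have hblockC (k : ℤ) := (Hu.opC_exchangesBlock k m).1
    have hs1 : (u • h) (ffd (2 * m - 1)) * opS (u • h) (m - 1)
        = -(opS (u • h) (m - 1) * (u • h) (ffd (2 * m - 1))) := by
      have hanti (w : Vertex) (hw : frustrationGraph.Adj (ffd (2 * m - 1)) w) := Hu.anti _ w hw
      unfold opS
      rw [mul_add, mul_add, add_mul, add_mul, neg_add, neg_add]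
      congr 1
      · congr 1 <;> exact hanti _ (by simp [abs_le]; try omega)
      · exact hanti _ (by simp; omega)
    have := odd_step K K' m (x := (u • h) (ffd (2 * m - 1)))
      (p := fun k => algebraMap ℂ A ((evenPoly c ε k).eval (u ^ 2)))
      (main (m - 1)).1 (main (m - 2)).1 e2 hs1
      (by rw [hblockA, IsFrustrated.signA, if_pos (by omega), neg_one_smul, neg_neg])
      (by rw [hblockC, IsFrustrated.signC, if_pos (by omega), neg_one_smul, neg_neg])
      (fun k hk => by
        have hc (w : Vertex) (hw : ¬ frustrationGraph.Adj (ffd (2 * m - 1)) w) :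
          Commute ((u • h) (ffd (2 * m - 1))) ((u • h) w) := Hu.comm _ w hw
        unfold opS
        refine .add_right (.add_right ?_ ?_) ?_ <;> refine hc _ ?_ <;> simp [abs_le] <;> omega)
      (fun k hk => by
        have := hblockA k
        rw [IsFrustrated.signA, if_neg (by omega), one_smul] at this
        exact this.symm)
      (fun k hk => by
        have := hblockC k
        rw [IsFrustrated.signC, if_neg (by omega), one_smul] at this
        exact this.symm)
    rw [Hu.sq] at this
    rw [show 2 * (m - 1) = 2 * m - 2 by ring, show 2 * (m - 2) = 2 * m - 4 by ring] at this
    rw [Pi.neg_apply, neg_mul, ← sub_eq_add_neg, this, ← map_mul, ← map_sub]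
    simp only [eval_sub, eval_mul, eval_C, eval_X, Pi.smul_apply, smul_eq_mul]
    ring_nf

end ExtendedFFD

/-! ### The transfer matrix of the algebra and the degree of `P_M` -/

namespace ExtendedFFD

open Vertex Polynomial

variable {c : Vertex → ℂ} {A : Type*} [Ring A] [Algebra ℂ A] {h : Vertex → A}

theorem IsFrustrated.commProd_smul (H : IsFrustrated c h) (z : ℂ) {S : Finset Vertex}
    (hS : frustrationGraph.IsIndepSet (S : Set Vertex)) :
    commProd (z • h) S = z ^ S.card • commProd h S := by
  classical
  induction S using Finset.induction_on with
  | empty => simp [commProd_empty]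
  | insert v S hv ih =>
    rw [(H.smul z).commProd_insert hv hS, H.commProd_insert hv hS, ih (hS.mono (by simp)),
      Finset.card_insert_of_notMem hv, Pi.smul_apply, smul_mul_smul_comm, pow_succ']

open Classical in
theorem IsFrustrated.indepSum_smul (H : IsFrustrated c h) (z : ℂ) (M : ℤ) :
    indepSum (z • h) (vertexSet M)
      = ∑ k ∈ Finset.range ((vertexSet M).card + 1),
          z ^ k • ∑ S ∈ indepSets M k, commProd h S := by
  unfold indepSum
  rw [Finset.sum_filter, Finset.sum_powerset]
  refine Finset.sum_congr rfl fun k _ => ?_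
  rw [← Finset.sum_filter, Finset.smul_sum]
  refine Finset.sum_congr rfl fun S hS => ?_
  rw [indepSets, Finset.mem_filter, Finset.mem_powersetCard] at hS
  rw [H.commProd_smul z hS.2, hS.1.2]

theorem isFrustrated_gen (N : ℕ) (c : Vertex → ℂ) : IsFrustrated c (gen N c) where
  sq v := by
    have := RingQuot.mkAlgHom_rel ℂ (Rel.sq (N := N) (c := c) v)
    simpa [gen] using this
  absent v hv := by
    have := RingQuot.mkAlgHom_rel ℂ (Rel.absent (N := N) (c := c) v hv)
    simpa [gen] using this
  anti v w hvw := by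
    have := RingQuot.mkAlgHom_rel ℂ (Rel.anticomm (N := N) (c := c) v w hvw)
    simpa [gen] using this
  comm _ _ hvw := gen_commute N c hvw

theorem IsFrustrated.map (H : IsFrustrated c h) {B : Type*} [Ring B] [Algebra ℂ B]
    (ρ : A →ₐ[ℂ] B) : IsFrustrated c (fun v => ρ (h v)) where
  sq v := by rw [← map_mul, H.sq v, AlgHom.commutes]
  absent v hv := by rw [H.absent v hv, map_zero]
  anti v w hvw := by rw [← map_mul, H.anti v w hvw, map_neg, map_mul]
  comm v w hvw := by rw [← map_mul, H.comm v w hvw, map_mul]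

/-- An element commuting with the generators is central. -/
theorem mem_center_of_forall_gen {N : ℕ} {c : Vertex → ℂ} {x : ExtAlgebra N c}
    (hx : ∀ v, x * gen N c v = gen N c v * x) : x ∈ Subalgebra.center ℂ (ExtAlgebra N c) := by
  rw [Subalgebra.mem_center_iff]
  intro y
  obtain ⟨y, rfl⟩ := RingQuot.mkAlgHom_surjective ℂ (Rel N c) y
  induction y using FreeAlgebra.induction with
  | grade0 r => rw [AlgHom.commutes, Algebra.commutes]
  | grade1 v => exact (hx v).symm
  | mul a b ha hb => rw [map_mul, mul_assoc, hb, ← mul_assoc, ha, mul_assoc]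
  | add a b ha hb => rw [map_add, add_mul, mul_add, ha, hb]

variable {N : ℕ} (ρ : ExtAlgebra N c →ₐ[ℂ] A)

open Classical in
theorem map_charge (M : ℤ) (k : ℕ) :
    ρ (charge N c M k) = ∑ S ∈ indepSets M k, commProd (fun v => ρ (gen N c v)) S := by
  rw [charge, map_sum, ← Finset.sum_attach (indepSets M k)]
  refine Finset.sum_congr rfl fun S _ => ?_
  have hS := (Finset.mem_filter.mp S.2).2
  rw [Finset.map_noncommProd, commProd, dif_pos (((isFrustrated_gen N c).map ρ).pairwise hS)]

theorem map_transfer (M : ℤ) (u : ℂ) :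
    ρ (transfer N c M u) = indepSum (-(u • fun v => ρ (gen N c v))) (vertexSet M) := by
  rw [← neg_smul, ((isFrustrated_gen N c).map ρ).indepSum_smul, transfer, map_sum]
  refine Finset.sum_congr rfl fun k _ => ?_
  rw [map_smul, map_charge]

theorem map_charge_zero (M : ℤ) : ρ (charge N c M 0) = 1 := by
  rw [map_charge]
  simp [indepSets, commProd_empty, Finset.filter_singleton, SimpleGraph.IsIndepSet]

/-- A polynomial over a complex algebra that vanishes at all scalars is zero: apply linear functionals
to its coefficients. -/
theorem eq_zero_of_forall_eval_algebraMap {G : A[X]}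
    (hG : ∀ u : ℂ, G.eval (algebraMap ℂ A u) = 0) : G = 0 := by
  ext k
  rw [coeff_zero, ← Module.forall_dual_apply_eq_zero_iff ℂ]
  intro f
  have hg : (∑ i ∈ G.support, C (f (G.coeff i)) * X ^ i : ℂ[X]) = 0 := by
    refine Polynomial.funext fun u => ?_
    have := congrArg f (hG u)
    rw [eval_eq_sum, Polynomial.sum, map_sum, map_zero] at this
    rw [eval_zero, eval_finsetSum, ← this]
    refine Finset.sum_congr rfl fun i _ => ?_
    rw [← map_pow, ← Algebra.commutes, ← Algebra.smul_def, map_smul,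
      eval_mul, eval_C, eval_pow, eval_X, smul_eq_mul, mul_comm]
  have := congrArg (fun p => coeff p k) hg
  simp only [finsetSum_coeff, coeff_C_mul, coeff_X_pow, mul_ite, mul_one, mul_zero,
    Finset.sum_ite_eq, coeff_zero] at this
  by_contra hne
  rw [if_pos (mem_support_iff.mpr fun h0 => hne (by rw [h0, map_zero]))] at this
  exact hne this

/-- The degree in an inversion relation. With `q s` the highest possible coefficient of the transfer
matrix, the coefficient of `u^{2s}` in `T(u) T(-u)` is `±q s ^ 2`. -/
theorem natDegree_of_inversion [Nontrivial A] {P : ℂ[X]} {q : ℕ → A} {s n : ℕ} (h0 : q 0 = 1)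
    (hs : ∀ k, s < k → q k = 0) (hn : ∀ k, n < k → q k = 0)
    (hP : ∀ u : ℂ, (∑ k ∈ Finset.range (n + 1), (-u) ^ k • q k) *
      (∑ k ∈ Finset.range (n + 1), u ^ k • q k) = P.eval (u ^ 2) • (1 : A)) :
    P.natDegree ≤ s ∧ (P.natDegree = s ↔ q s ^ 2 ≠ 0) := by
  -- `T(u)` and `T(-u)` as polynomials over `A`
  set T : A[X] := ∑ k ∈ Finset.range (n + 1), C ((-1 : ℂ) ^ k • q k) * X ^ k with hT
  set T' : A[X] := ∑ k ∈ Finset.range (n + 1), C (q k) * X ^ k with hT'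
  have cT (k : ℕ) : T.coeff k = (-1 : ℂ) ^ k • q k := by
    simp only [hT, finsetSum_coeff, coeff_C_mul, coeff_X_pow, mul_ite, mul_one, mul_zero,
      Finset.sum_ite_eq, Finset.mem_range]
    split_ifs with hk
    · rfl
    · rw [hn k (by omega), smul_zero]
  have cT' (k : ℕ) : T'.coeff k = q k := by
    simp only [hT', finsetSum_coeff, coeff_C_mul, coeff_X_pow, mul_ite, mul_one, mul_zero,
      Finset.sum_ite_eq, Finset.mem_range]
    split_ifs with hk
    · rfl
    · rw [hn k (by omega)]
  have dT : T.natDegree ≤ s :=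
    natDegree_le_iff_coeff_eq_zero.mpr fun k hk => by rw [cT, hs k hk, smul_zero]
  have dT' : T'.natDegree ≤ s :=
    natDegree_le_iff_coeff_eq_zero.mpr fun k hk => by rw [cT', hs k hk]
  have key : T * T' = (expand ℂ 2 P).map (algebraMap ℂ A) := by
    rw [← sub_eq_zero]
    refine eq_zero_of_forall_eval_algebraMap fun u => ?_
    have hmul : (T * T').eval (algebraMap ℂ A u)
        = T.eval (algebraMap ℂ A u) * T'.eval (algebraMap ℂ A u) := by
      unfold eval
      exact eval₂_mul_noncomm _ _ fun k => (Algebra.commutes u _).symm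
    have hpow (x : A) (k : ℕ) : x * algebraMap ℂ A u ^ k = u ^ k • x := by
      rw [← map_pow, ← Algebra.commutes, ← Algebra.smul_def]
    rw [eval_sub, hmul, eval_map, eval₂_at_apply, expand_eval, hT, hT', eval_finsetSum,
      eval_finsetSum, Algebra.algebraMap_eq_smul_one (P.eval _), ← hP u, sub_eq_zero]
    congr 1 <;> refine Finset.sum_congr rfl fun k _ => ?_
    · rw [eval_C_mul, eval_X_pow, hpow, smul_smul, ← mul_pow, mul_neg_one]
    · rw [eval_C_mul, eval_X_pow, hpow]
  have hinj : Function.Injective (algebraMap ℂ A) := (algebraMap ℂ A).injective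
  have cP (k : ℕ) : algebraMap ℂ A (P.coeff k) = (T * T').coeff (k + k) := by
    rw [key, coeff_map, ← mul_two, coeff_expand_mul two_pos]
  have hle : P.natDegree ≤ s := natDegree_le_iff_coeff_eq_zero.mpr fun k hk => by
    rw [← map_eq_zero_iff _ hinj, cP]
    exact coeff_eq_zero_of_natDegree_lt (by have := natDegree_mul_le (p := T) (q := T'); omega)
  have htop : algebraMap ℂ A (P.coeff s) = (-1 : ℂ) ^ s • q s ^ 2 := by
    rw [cP, coeff_mul_add_eq_of_natDegree_le dT dT', cT, cT', smul_mul_assoc, pow_two]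
  have hiff : P.coeff s ≠ 0 ↔ q s ^ 2 ≠ 0 := by
    rw [not_iff_not, ← map_eq_zero_iff _ hinj, htop, smul_eq_zero_iff_right (by simp)]
  refine ⟨hle, ?_, fun hq => le_antisymm hle (le_natDegree_of_ne_zero (hiff.mpr hq))⟩
  intro hd
  rcases Nat.eq_zero_or_pos s with rfl | hpos
  · simp [h0]
  · rw [← hiff, ← hd]
    exact leadingCoeff_ne_zero.mpr fun hP0 => by simp [hP0] at hd; omega

end ExtendedFFD

/-! ### The independence number -/

namespace ExtendedFFD

open Vertex

instance finite_present (c : Vertex → ℂ) (M : ℤ) :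
    Finite {v | v ∈ vertexSet M ∧ c v ≠ 0} :=
  Set.Finite.subset (vertexSet M).finite_toSet fun _ hv => hv.1

theorem card_le_indepNumber {c : Vertex → ℂ} {M : ℤ} {S : Finset Vertex}
    (hS : frustrationGraph.IsIndepSet (S : Set Vertex)) (hM : S ⊆ vertexSet M)
    (hc : ∀ v ∈ S, c v ≠ 0) : S.card ≤ indepNumber c M := by
  classical
  have hmem (v : Vertex) (hv : v ∈ S) : v ∈ {v | v ∈ vertexSet M ∧ c v ≠ 0} :=
    ⟨hM hv, hc v hv⟩
  have := SimpleGraph.IsIndepSet.card_le_indepNum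
    (G := frustrationGraph.induce {v | v ∈ vertexSet M ∧ c v ≠ 0})
    (t := S.subtype (· ∈ {v | v ∈ vertexSet M ∧ c v ≠ 0})) ?_
  · rwa [Finset.card_subtype, Finset.filter_true_of_mem hmem] at this
  · intro v hv w hw hne
    rw [Finset.mem_coe, Finset.mem_subtype] at hv hw
    exact hS hv hw (fun h => hne (Subtype.ext h))

theorem exists_card_eq_indepNumber (c : Vertex → ℂ) (M : ℤ) :
    ∃ S : Finset Vertex, frustrationGraph.IsIndepSet (S : Set Vertex) ∧ S ⊆ vertexSet M ∧
      (∀ v ∈ S, c v ≠ 0) ∧ S.card = indepNumber c M := by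
  obtain ⟨s, hs, hcard⟩ := SimpleGraph.exists_isNIndepSet_indepNum
    (G := frustrationGraph.induce {v | v ∈ vertexSet M ∧ c v ≠ 0})
  refine ⟨s.map (Function.Embedding.subtype _), ?_, ?_, ?_, ?_⟩
  · intro v hv w hw hne
    simp only [Finset.coe_map, Set.mem_image] at hv hw
    obtain ⟨v, hv, rfl⟩ := hv
    obtain ⟨w, hw, rfl⟩ := hw
    exact hs hv hw (fun h => hne (by rw [h]))
  · intro v hv
    obtain ⟨v, hv, rfl⟩ := Finset.mem_map.mp hv
    exact v.2.1
  · intro v hv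
    obtain ⟨v, hv, rfl⟩ := Finset.mem_map.mp hv
    exact v.2.2
  · rw [Finset.card_map, hcard]; rfl

theorem charge_eq_zero {N : ℕ} {c : Vertex → ℂ} {A : Type*} [Ring A] [Algebra ℂ A]
    (ρ : ExtAlgebra N c →ₐ[ℂ] A) {M : ℤ} {k : ℕ} (hk : indepNumber c M < k) :
    ρ (charge N c M k) = 0 := by
  classical
  have H := (isFrustrated_gen N c).map ρ
  rw [map_charge]
  refine Finset.sum_eq_zero fun S hS => ?_
  rw [indepSets, Finset.mem_filter, Finset.mem_powersetCard] at hS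
  obtain ⟨⟨hM, hcard⟩, hS⟩ := hS
  by_cases hc : ∀ v ∈ S, c v ≠ 0
  · have := card_le_indepNumber hS hM hc
    omega
  · push Not at hc
    obtain ⟨v, hv, h0⟩ := hc
    exact H.commProd_eq_zero hS hv (H.absent v h0)

/-- The upper bound on independent sets, with `e = 0` if the label `\overline 1` is excluded and
`e = 1` otherwise. Picking one vertex of the last block leaves an independent set in `G_{M-3}`, or
in one of its neighbours in the recursion; picking `\overline{2m+1}` may also allow `2m-2`, and
then the rest lies in `G_{2m-6}`. -/
theorem card_indepSet_bound {e : ℤ} (he : 0 ≤ e) (n : ℕ) : ∀ (M : ℤ), M + 2 < n → -2 ≤ M →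
    ∀ S : Finset Vertex, frustrationGraph.IsIndepSet (S : Set Vertex) → S ⊆ vertexSet M →
      (e = 0 → bar 0 ∉ S) → 3 * (S.card : ℤ) ≤ M + 2 + e := by
  classical
  induction n with
  | zero => intro M h1 h2; simp at h1; omega
  | succ n ih =>
    intro M hn hM S hS hSM h0
    push_cast at hn
    have hadj {v w : Vertex} (hv : v ∈ S) (hw : w ∈ S) (hne : v ≠ w) :
        ¬ frustrationGraph.Adj v w := hS hv hw hne
    have herase {v : Vertex} (hv : v ∈ S) {M' : ℤ} (h1 : -2 ≤ M') (h2 : M' < M)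
        (hsub : S.erase v ⊆ vertexSet M') : 3 * (S.card : ℤ) ≤ M' + 5 + e := by
      have := ih M' (by omega) h1 (S.erase v) (hS.mono (by simp)) hsub
        (fun h h' => h0 h (Finset.mem_of_mem_erase h'))
      rw [Finset.card_erase_of_mem hv] at this
      have hpos := Finset.card_pos.mpr ⟨v, hv⟩
      omega
    have hf {j : ℤ} (hj : ffd j ∈ S) : 1 ≤ j ∧ j ≤ M := ffd_mem_vertexSet.mp (hSM hj)
    have hb {k : ℤ} (hk : bar k ∈ S) : 0 ≤ k ∧ k ≤ M / 2 := bar_mem_vertexSet.mp (hSM hk)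
    rcases lt_or_ge M 1 with hM1 | hM1
    · -- only the vertex `bar 0` can be present
      have hsub : S ⊆ {bar 0} := by
        rintro (j | k) hv
        · have := hf hv; omega
        · have := hb hv
          rw [Finset.mem_singleton, bar.injEq]; omega
      rcases Finset.subset_singleton_iff.mp hsub with rfl | rfl
      · simp; omega
      · have := hb (Finset.mem_singleton_self _)
        have : e ≠ 0 := fun h => h0 h (Finset.mem_singleton_self _)
        simp; omega
    rcases Int.even_or_odd' M with ⟨m, rfl | rfl⟩
    · by_cases h1 : ffd (2 * m - 1) ∈ S
      · have := herase h1 (M' := 2 * m - 4) (by omega) (by omega) (by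
          rintro (j | k) hv <;> obtain ⟨hne, hv⟩ := Finset.mem_erase.mp hv
          · have h3 := hadj h1 hv hne.symm
            have := hf hv
            simp [abs_le] at h3 hne ⊢; omega
          · have h3 := hadj h1 hv hne.symm
            have := hb hv
            simp at h3 ⊢; omega)
        omega
      by_cases h2 : ffd (2 * m) ∈ S
      · have := herase h2 (M' := 2 * m - 3) (by omega) (by omega) (by
          rintro (j | k) hv <;> obtain ⟨hne, hv⟩ := Finset.mem_erase.mp hv
          · have h3 := hadj h2 hv hne.symm
            have := hf hv
            simp [abs_le] at h3 hne ⊢; omega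
          · have h3 := hadj h2 hv hne.symm
            have := hb hv
            simp at h3 ⊢; omega)
        omega
      have hne1 (j : ℤ) (hj : ffd j ∈ S) : j ≠ 2 * m - 1 := by rintro rfl; exact h1 hj
      have hne2 (j : ℤ) (hj : ffd j ∈ S) : j ≠ 2 * m := by rintro rfl; exact h2 hj
      by_cases h4 : bar m ∈ S
      · by_cases h5 : ffd (2 * m - 2) ∈ S
        · have h6 := hf h5
          have := ih (2 * m - 6) (by omega) (by omega) ((S.erase (bar m)).erase (ffd (2 * m - 2)))
            (hS.mono (fun v hv => Finset.mem_of_mem_erase (Finset.mem_of_mem_erase hv))) (by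
            rintro (j | k) hv <;> obtain ⟨hne, hv⟩ := Finset.mem_erase.mp hv <;>
              obtain ⟨hne', hv⟩ := Finset.mem_erase.mp hv
            · have h7 := hadj h5 hv hne.symm
              have h8 := hadj h4 hv hne'.symm
              have := hf hv
              have := hne1 j hv
              have := hne2 j hv
              simp [abs_le] at h7 h8 hne ⊢; omega
            · have h7 := hadj h5 hv hne.symm
              have h8 := hadj h4 hv hne'.symm
              have := hb hv
              simp [abs_eq] at h7 h8 hne' ⊢; omega)
            (fun h h' => h0 h (Finset.mem_of_mem_erase (Finset.mem_of_mem_erase h')))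
          rw [Finset.card_erase_of_mem (by simp [h5]), Finset.card_erase_of_mem h4] at this
          have hpos : 2 ≤ S.card := by
            have := Finset.card_le_card (show {bar m, ffd (2 * m - 2)} ⊆ S by
              intro v hv; simp at hv; rcases hv with rfl | rfl <;> assumption)
            simpa using this
          omega
        · have := herase h4 (M' := 2 * m - 4) (by omega) (by omega) (by
            rintro (j | k) hv <;> obtain ⟨hne, hv⟩ := Finset.mem_erase.mp hv
            · have h3 := hadj h4 hv hne.symm
              have := hf hv
              have := hne1 j hv
              have := hne2 j hv
              have : j ≠ 2 * m - 2 := by rintro rfl; exact h5 hv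
              simp at h3 ⊢; omega
            · have h3 := hadj h4 hv hne.symm
              have := hb hv
              simp [abs_eq] at h3 hne ⊢; omega)
          omega
      · have := ih (2 * m - 2) (by omega) (by omega) S hS (by
          rintro (j | k) hv
          · have := hf hv
            have := hne1 j hv
            have := hne2 j hv
            simp; omega
          · have := hb hv
            have : k ≠ m := by rintro rfl; exact h4 hv
            simp; omega) h0
        omega
    · by_cases h1 : ffd (2 * m + 1) ∈ S
      · have := herase h1 (M' := 2 * m - 2) (by omega) (by omega) (by
          rintro (j | k) hv <;> obtain ⟨hne, hv⟩ := Finset.mem_erase.mp hv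
          · have h3 := hadj h1 hv hne.symm
            have := hf hv
            simp [abs_le] at h3 hne ⊢; omega
          · have h3 := hadj h1 hv hne.symm
            have := hb hv
            simp at h3 ⊢; omega)
        omega
      · have := ih (2 * m) (by omega) (by omega) S hS (by
          rintro (j | k) hv
          · have := hf hv
            have : j ≠ 2 * m + 1 := by rintro rfl; exact h1 hv
            simp; omega
          · have := hb hv
            simp; omega) h0
        omega

theorem indepNumber_le {c : Vertex → ℂ} {M e : ℤ} (hM : -2 ≤ M) (he : 0 ≤ e)
    (hc : e = 0 → c (bar 0) = 0) : 3 * (indepNumber c M : ℤ) ≤ M + 2 + e := by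
  obtain ⟨S, hS, hSM, hSc, hcard⟩ := exists_card_eq_indepNumber c M
  rw [← hcard]
  exact card_indepSet_bound he ((M + 3).toNat) M (by omega) hM S hS hSM
    fun h h' => hSc _ h' (hc h)

/-- The labels `1, 4, 7, …` are independent. -/
theorem le_indepNumber {c : Vertex → ℂ} {M : ℤ}
    (hc : ∀ j : ℤ, 1 ≤ j → j ≤ M → c (ffd j) ≠ 0) {n : ℕ} (hn : 3 * (n : ℤ) ≤ M + 2) :
    n ≤ indepNumber c M := by
  have hinj : Function.Injective fun i : ℕ => ffd (3 * i + 1) := fun i j h => by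
    simp only [ffd.injEq] at h; omega
  have := card_le_indepNumber (c := c) (M := M)
    (S := (Finset.range n).map ⟨fun i : ℕ => ffd (3 * i + 1), hinj⟩) ?_ ?_ ?_
  · simpa using this
  · rintro v hv w hw hne
    simp only [Finset.coe_map, Function.Embedding.coeFn_mk, Set.mem_image] at hv hw
    obtain ⟨i, -, rfl⟩ := hv
    obtain ⟨j, -, rfl⟩ := hw
    simp [abs_le] at hne ⊢; omega
  · intro v hv
    simp only [Finset.mem_map, Finset.mem_range, Function.Embedding.coeFn_mk] at hv
    obtain ⟨i, hi, rfl⟩ := hv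
    simp; omega
  · intro v hv
    simp only [Finset.mem_map, Finset.mem_range, Function.Embedding.coeFn_mk] at hv
    obtain ⟨i, hi, rfl⟩ := hv
    exact hc _ (by omega) (by omega)

/-- The labels `\overline 1, 3, 6, 9, …` are independent. -/
theorem le_indepNumber_of_bar {c : Vertex → ℂ} {M : ℤ} (h0 : c (bar 0) ≠ 0)
    (hc : ∀ j : ℤ, 1 ≤ j → j ≤ M → c (ffd j) ≠ 0) {n : ℕ} (hn : 3 * (n : ℤ) ≤ M) :
    n + 1 ≤ indepNumber c M := by
  classical
  have hinj : Function.Injective fun i : ℕ => ffd (3 * i + 3) := fun i j h => by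
    simp only [ffd.injEq] at h; omega
  have := card_le_indepNumber (c := c) (M := M)
    (S := insert (bar 0) ((Finset.range n).map ⟨fun i : ℕ => ffd (3 * i + 3), hinj⟩)) ?_ ?_ ?_
  · rwa [Finset.card_insert_of_notMem (by simp), Finset.card_map, Finset.card_range] at this
  · rw [isIndepSet_insert (by simp)]
    constructor
    · rintro v hv w hw hne
      simp only [Finset.coe_map, Function.Embedding.coeFn_mk, Set.mem_image] at hv hw
      obtain ⟨i, -, rfl⟩ := hv
      obtain ⟨j, -, rfl⟩ := hw
      simp [abs_le] at hne ⊢; omega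
    · intro v hv
      simp only [Finset.mem_map, Finset.mem_range, Function.Embedding.coeFn_mk] at hv
      obtain ⟨i, hi, rfl⟩ := hv
      simp; omega
  · intro v hv
    simp only [Finset.mem_insert, Finset.mem_map, Finset.mem_range,
      Function.Embedding.coeFn_mk] at hv
    rcases hv with rfl | ⟨i, hi, rfl⟩ <;> simp <;> omega
  · intro v hv
    simp only [Finset.mem_insert, Finset.mem_map, Finset.mem_range,
      Function.Embedding.coeFn_mk] at hv
    rcases hv with rfl | ⟨i, hi, rfl⟩
    · exact h0
    · exact hc _ (by omega) (by omega)

theorem indepNumber_eq {c : Vertex → ℂ} {M : ℤ} (hM : 0 ≤ M)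
    (hc : ∀ j : ℤ, 1 ≤ j → j ≤ M → c (ffd j) ≠ 0) :
    (c (bar 0) = 0 → (indepNumber c M : ℤ) = (M + 2) / 3) ∧
      (c (bar 0) ≠ 0 → (indepNumber c M : ℤ) = M / 3 + 1) := by
  constructor <;> intro h0
  · have h1 := indepNumber_le (M := M) (by omega) le_rfl fun _ => h0
    have h2 := le_indepNumber hc (n := ((M + 2) / 3).toNat) (by omega)
    omega
  · have h1 := indepNumber_le (c := c) (M := M) (e := 1) (by omega) zero_le_one (by simp)
    have h2 := le_indepNumber_of_bar h0 hc (n := (M / 3).toNat) (by omega)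
    omega

end ExtendedFFD

/-! ### The degree of `P_M` for real couplings -/

namespace ExtendedFFD

open Vertex Polynomial

open scoped ComplexOrder

/-- The coefficients of `P` are real with alternating signs, starting with a nonnegative one. -/
def AlternatingCoeffs (P : ℂ[X]) : Prop := ∀ k, 0 ≤ (-1) ^ k * P.coeff k

namespace AlternatingCoeffs

variable {P Q : ℂ[X]}

theorem one : AlternatingCoeffs 1 := by
  intro k
  rw [coeff_one]
  split_ifs with h <;> simp [h]

theorem add (hP : AlternatingCoeffs P) (hQ : AlternatingCoeffs Q) : AlternatingCoeffs (P + Q) := by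
  intro k
  rw [coeff_add, mul_add]
  exact add_nonneg (hP k) (hQ k)

theorem neg_X_mul (hP : AlternatingCoeffs P) {a : ℂ} (ha : 0 ≤ a) :
    AlternatingCoeffs (-(C a * X * P)) := by
  rintro (_ | k)
  · simp [mul_assoc]
  · rw [coeff_neg, mul_assoc, coeff_C_mul, coeff_X_mul]
    have := mul_nonneg ha (hP k)
    calc 0 ≤ a * ((-1) ^ k * P.coeff k) := this
      _ = _ := by ring

theorem X_sq_mul (hP : AlternatingCoeffs P) {a : ℂ} (ha : 0 ≤ a) :
    AlternatingCoeffs (C a * X ^ 2 * P) := by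
  have := (hP.neg_X_mul ha).neg_X_mul zero_le_one
  rw [C_1] at this
  convert this using 1
  ring

theorem coeff_add_ne_zero (hP : AlternatingCoeffs P) (hQ : AlternatingCoeffs Q) {k : ℕ}
    (hk : Q.coeff k ≠ 0) : (P + Q).coeff k ≠ 0 := by
  intro h
  rw [coeff_add] at h
  have h1 : (-1) ^ k * P.coeff k + (-1) ^ k * Q.coeff k = 0 := by rw [← mul_add, h, mul_zero]
  have h2 := ((add_eq_zero_iff_of_nonneg (hP k) (hQ k)).mp h1).2
  exact hk (by simpa using h2)

end AlternatingCoeffs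

section

variable {c : Vertex → ℂ} {ε : ℤ → ℤˣ}

theorem natDegree_C_mul_X_mul_le {a : ℂ} {P : ℂ[X]} {d : ℤ} (h0 : 0 ≤ d)
    (h : a ≠ 0 → (P.natDegree : ℤ) + 1 ≤ d) : ((C a * X * P).natDegree : ℤ) ≤ d := by
  by_cases ha : a = 0
  · simpa [ha] using h0
  · have := natDegree_mul_le (p := C a * X) (q := P)
    have := natDegree_C_mul_X_pow_le a 1
    rw [pow_one] at this
    have := h ha
    omega

theorem natDegree_C_mul_X_sq_mul_le {a : ℂ} {P : ℂ[X]} {d : ℤ} (h0 : 0 ≤ d)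
    (h : a ≠ 0 → (P.natDegree : ℤ) + 2 ≤ d) : ((C a * X ^ 2 * P).natDegree : ℤ) ≤ d := by
  by_cases ha : a = 0
  · simpa [ha] using h0
  · have := natDegree_mul_le (p := C a * X ^ 2) (q := P)
    have := natDegree_C_mul_X_pow_le a 2
    have := h ha
    omega

theorem evenPoly_zero (hcf : ∀ j < 1, c (ffd j) = 0) :
    evenPoly c ε 0 = 1 - C (c (bar 0) ^ 2) * X := by
  rw [evenPoly_step c ε le_rfl]
  simp [evenPoly_neg, scalarS, scalarA, scalarC, hcf]

theorem natDegree_evenPoly_le (hcf : ∀ j < 1, c (ffd j) = 0) {e : ℤ} (he : 0 ≤ e)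
    (he0 : e = 0 → c (bar 0) = 0) (n : ℕ) : ∀ m : ℤ, -1 ≤ m → m < n →
    ((evenPoly c ε m).natDegree : ℤ) ≤ (2 * m + 2 + e) / 3 := by
  induction n with
  | zero =>
    intro m h1 h2
    rw [evenPoly_neg c ε (by simpa using h2)]
    simp; omega
  | succ n ih =>
    intro m h1 h2
    push_cast at h2
    rcases lt_or_ge m 0 with hm | hm
    · rw [evenPoly_neg c ε hm]
      simp; omega
    rw [evenPoly_step c ε hm]
    have i1 := ih (m - 1) (by omega) (by omega)
    have d1 := natDegree_C_mul_X_mul_le (a := scalarS c m) (P := evenPoly c ε (m - 2))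
      (d := (2 * m + 2 + e) / 3) (by omega) (fun ha => by
        rcases eq_or_lt_of_le hm with rfl | hm
        · have : e ≠ 0 := fun h => ha (by simp [scalarS, hcf, he0 h])
          rw [evenPoly_neg c ε (by omega)]
          simp; omega
        · have := ih (m - 2) (by omega) (by omega)
          omega)
    have d2 := natDegree_C_mul_X_sq_mul_le (a := scalarA c ε m) (P := evenPoly c ε (m - 3))
      (d := (2 * m + 2 + e) / 3) (by omega) (fun ha => by
        rcases lt_or_ge m 2 with hm' | hm'
        · exact absurd (by simp [scalarA, hcf (2 * m - 3) (by omega), hcf (2 * m - 2) (by omega)]) ha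
        · have := ih (m - 3) (by omega) (by omega)
          omega)
    have d3 := natDegree_C_mul_X_sq_mul_le (a := scalarC c m) (P := evenPoly c ε (m - 4))
      (d := (2 * m + 2 + e) / 3) (by omega) (fun ha => by
        rcases lt_or_ge m 3 with hm' | hm'
        · exact absurd (by simp [scalarC, hcf (2 * m - 5) (by omega)]) ha
        · have := ih (m - 4) (by omega) (by omega)
          omega)
    have t1 := natDegree_sub_le (evenPoly c ε (m - 1)) (C (scalarS c m) * X * evenPoly c ε (m - 2))
    have t2 := natDegree_add_le
      (evenPoly c ε (m - 1) - C (scalarS c m) * X * evenPoly c ε (m - 2))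
      (C (scalarA c ε m) * X ^ 2 * evenPoly c ε (m - 3))
    have t3 := natDegree_sub_le
      (evenPoly c ε (m - 1) - C (scalarS c m) * X * evenPoly c ε (m - 2)
        + C (scalarA c ε m) * X ^ 2 * evenPoly c ε (m - 3))
      (C (scalarC c m) * X ^ 2 * evenPoly c ε (m - 4))
    omega

theorem sq_nonneg_of_im_eq_zero {z : ℂ} (hz : z.im = 0) : 0 ≤ z ^ 2 := by
  obtain ⟨r, rfl⟩ : ∃ r : ℝ, z = r := ⟨z.re, Complex.ext rfl (by simp [hz])⟩
  exact_mod_cast sq_nonneg r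

theorem scalarA_nonneg (hr : ∀ v, (c v).im = 0) (m : ℤ) : 0 ≤ scalarA c ε m := by
  refine sq_nonneg_of_im_eq_zero ?_
  simp [hr]

/-- `P_{2m}(z) + z b_{2m-1}² P_{2m-4}(z)`, the polynomial that belongs to `G_{2m}` with the vertex
`2m-1` removed. -/
noncomputable def evenPolyErase (c : Vertex → ℂ) (ε : ℤ → ℤˣ) (m : ℤ) : ℂ[X] :=
  evenPoly c ε m + C (c (ffd (2 * m - 1)) ^ 2) * X * evenPoly c ε (m - 2)

theorem evenPolyErase_neg (hcf : ∀ j < 1, c (ffd j) = 0) {m : ℤ} (hm : m < 0) : evenPolyErase c ε m = 1 := by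
  simp [evenPolyErase, evenPoly_neg c ε hm, hcf (2 * m - 1) (by omega)]

/-- The negative term `-b_{2m-5}² \bar b_{2m+1}² z²` of the recursion is absorbed into
`evenPolyErase`, so that all terms have alternating signs. -/
theorem evenPolyErase_step {m : ℤ} (hm : 0 ≤ m) : evenPolyErase c ε m =
    evenPoly c ε (m - 1) + -(C (c (ffd (2 * m)) ^ 2) * X * evenPoly c ε (m - 2))
      + -(C (c (bar m) ^ 2) * X * evenPolyErase c ε (m - 2))
      + C (scalarA c ε m) * X ^ 2 * evenPoly c ε (m - 3) := by
  rw [evenPolyErase, evenPolyErase, evenPoly_step c ε hm, show 2 * (m - 2) - 1 = 2 * m - 5 by ring,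
    show m - 2 - 2 = m - 4 by ring, scalarS, scalarC, C_add, C_add, C_mul]
  ring

theorem alternatingCoeffs_evenPoly (hr : ∀ v, (c v).im = 0) (hcf : ∀ j < 1, c (ffd j) = 0)
    (m : ℤ) : AlternatingCoeffs (evenPoly c ε m) ∧ AlternatingCoeffs (evenPolyErase c ε m) := by
  suffices h : ∀ (n : ℕ) (m : ℤ), m < n →
      AlternatingCoeffs (evenPoly c ε m) ∧ AlternatingCoeffs (evenPolyErase c ε m) from
    h (m.toNat + 1) m (by have := Int.self_le_toNat m; push_cast; omega)
  intro n
  induction n with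
  | zero =>
    intro m hm
    rw [evenPoly_neg c ε (by simpa using hm), evenPolyErase_neg hcf (by simpa using hm)]
    exact ⟨.one, .one⟩
  | succ n ih =>
    intro m hmn
    push_cast at hmn
    rcases lt_or_ge m 0 with hm | hm
    · rw [evenPoly_neg c ε hm, evenPolyErase_neg hcf hm]
      exact ⟨.one, .one⟩
    have hsq (v : Vertex) : 0 ≤ c v ^ 2 := sq_nonneg_of_im_eq_zero (hr v)
    have haux : AlternatingCoeffs (evenPolyErase c ε m) := by
      rw [evenPolyErase_step hm]
      exact (((ih _ (by omega)).1.add ((ih _ (by omega)).1.neg_X_mul (hsq _))).add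
        ((ih _ (by omega)).2.neg_X_mul (hsq _))).add
        ((ih _ (by omega)).1.X_sq_mul (scalarA_nonneg hr m))
    refine ⟨?_, haux⟩
    have : evenPoly c ε m
        = evenPolyErase c ε m + -(C (c (ffd (2 * m - 1)) ^ 2) * X * evenPoly c ε (m - 2)) := by
      rw [evenPolyErase]; ring
    rw [this]
    exact haux.add ((ih _ (by omega)).1.neg_X_mul (hsq _))

/-- The coefficient of degree `⌊(2m+2+e)/3⌋` does not vanish. With alternating signs nothing cancels,
so one contributing term is enough: the `A` term, which raises the degree by two as `m` grows by
three. -/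
theorem coeff_evenPoly_ne_zero (hr : ∀ v, (c v).im = 0) (hcf : ∀ j < 1, c (ffd j) = 0)
    {e : ℤ} (he : e = 0 ∨ e = 1) (he0 : e = 1 → c (bar 0) ≠ 0) (n : ℕ) : ∀ m : ℤ, -1 ≤ m → m < n →
    (∀ j : ℤ, 1 ≤ j → j ≤ 2 * m → c (ffd j) ≠ 0) →
    (∀ k : ℤ, 2 ≤ k → k ≤ m → scalarA c ε k ≠ 0) →
    ∀ d : ℕ, (d : ℤ) = (2 * m + 2 + e) / 3 → (evenPoly c ε m).coeff d ≠ 0 := by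
  have alt := alternatingCoeffs_evenPoly (ε := ε) hr hcf
  have hsq (v : Vertex) : 0 ≤ c v ^ 2 := sq_nonneg_of_im_eq_zero (hr v)
  have hneg (m : ℤ) (hm : m < 0) (h1 : -1 ≤ m) (d : ℕ) (hd : (d : ℤ) = (2 * m + 2 + e) / 3) :
      (evenPoly c ε m).coeff d ≠ 0 := by
    obtain rfl : d = 0 := by omega
    rw [evenPoly_neg c ε hm]
    simp
  induction n with
  | zero => exact fun m h1 h2 _ _ d hd => hneg m (by simpa using h2) h1 d hd
  | succ n ih =>
    intro m h1 h2 hb ha d hd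
    push_cast at h2
    rcases lt_or_ge m 0 with hm | hm
    · exact hneg m hm h1 d hd
    rcases lt_or_ge m 2 with hm2 | hm2
    · obtain rfl | rfl : m = 0 ∨ m = 1 := by omega
      · rw [evenPoly_zero hcf]
        rcases he with rfl | rfl
        · obtain rfl : d = 0 := by omega
          simp
        · obtain rfl : d = 1 := by omega
          rw [coeff_sub, coeff_one, coeff_C_mul, coeff_X_one]
          simpa using he0 rfl
      · obtain rfl : d = 1 := by omega
        have : evenPoly c ε 1
            = evenPolyErase c ε 1 + -(C (c (ffd (2 * 1 - 1)) ^ 2) * X * evenPoly c ε (1 - 2)) := by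
          rw [evenPolyErase]; ring
        rw [this]
        refine (alt 1).2.coeff_add_ne_zero ((alt _).1.neg_X_mul (hsq _)) ?_
        rw [evenPoly_neg c ε (by norm_num), mul_one, coeff_neg, coeff_C_mul, coeff_X_one]
        simpa using hb 1 le_rfl (by norm_num)
    · obtain ⟨d, rfl⟩ : ∃ d', d = d' + 2 := ⟨d - 2, by omega⟩
      have : evenPoly c ε m = evenPoly c ε (m - 1)
          + -(C (c (ffd (2 * m)) ^ 2) * X * evenPoly c ε (m - 2))
          + -(C (c (bar m) ^ 2) * X * evenPolyErase c ε (m - 2))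
          + -(C (c (ffd (2 * m - 1)) ^ 2) * X * evenPoly c ε (m - 2))
          + C (scalarA c ε m) * X ^ 2 * evenPoly c ε (m - 3) := by
        have := evenPolyErase_step (c := c) (ε := ε) hm
        rw [evenPolyErase] at this
        linear_combination this
      rw [this]
      refine AlternatingCoeffs.coeff_add_ne_zero ((((alt _).1.add ((alt _).1.neg_X_mul (hsq _))).add
        ((alt _).2.neg_X_mul (hsq _))).add ((alt _).1.neg_X_mul (hsq _)))
        ((alt _).1.X_sq_mul (scalarA_nonneg hr m)) ?_
      rw [mul_assoc, coeff_C_mul, coeff_X_pow_mul]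
      exact mul_ne_zero (ha m hm2 le_rfl) (ih (m - 3) (by omega) (by omega)
        (fun j hj hj' => hb j hj (by omega)) (fun k hk hk' => ha k hk (by omega)) d
        (by push_cast at hd; omega))

theorem natDegree_inversionPoly (hr : ∀ v, (c v).im = 0) (hcf : ∀ j < 1, c (ffd j) = 0)
    {M : ℤ} (hM : 0 ≤ M)
    (hb : ∀ j : ℤ, 1 ≤ j → j ≤ M → c (ffd j) ≠ 0)
    (ha : ∀ m : ℤ, 2 ≤ m → 2 * m ≤ M → scalarA c ε m ≠ 0) :
    (inversionPoly c ε M).natDegree = indepNumber c M := by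
  obtain ⟨e, he, he1, he0, hS⟩ : ∃ e : ℤ, (e = 0 ∨ e = 1) ∧ (e = 1 → c (bar 0) ≠ 0) ∧
      (e = 0 → c (bar 0) = 0) ∧ (indepNumber c M : ℤ) = (M + 2 + e) / 3 := by
    have := indepNumber_eq hM hb
    by_cases h0 : c (bar 0) = 0
    · exact ⟨0, .inl rfl, by simp, fun _ => h0, by rw [this.1 h0]; omega⟩
    · exact ⟨1, .inr rfl, fun _ => h0, by simp, by rw [this.2 h0]; omega⟩
  have hup (m : ℤ) (h1 : -1 ≤ m) := natDegree_evenPoly_le (ε := ε) hcf (e := e) (by omega) he0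
    (m + 1).toNat m h1 (by omega)
  have hlow (m : ℤ) (h1 : -1 ≤ m) := coeff_evenPoly_ne_zero (ε := ε) hr hcf he he1
    (m + 1).toNat m h1 (by omega)
  rcases Int.even_or_odd' M with ⟨m, rfl | rfl⟩
  · rw [inversionPoly_even]
    refine le_antisymm (by have := hup m (by omega); omega) (le_natDegree_of_ne_zero ?_)
    exact hlow m (by omega) hb (fun k hk hk' => ha k hk (by omega)) _ hS
  · obtain ⟨m, rfl⟩ : ∃ k, m = k - 1 := ⟨m + 1, by ring⟩
    rw [show 2 * (m - 1) + 1 = 2 * m - 1 by ring] at *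
    rw [inversionPoly_odd]
    refine le_antisymm ?_ (le_natDegree_of_ne_zero ?_)
    · have i1 := hup (m - 1) (by omega)
      have d1 := natDegree_C_mul_X_mul_le (a := c (ffd (2 * m - 1)) ^ 2)
        (P := evenPoly c ε (m - 2)) (d := (2 * m - 1 + 2 + e) / 3) (by omega)
        (fun _ => by have := hup (m - 2) (by omega); omega)
      have t1 := natDegree_sub_le (evenPoly c ε (m - 1))
        (C (c (ffd (2 * m - 1)) ^ 2) * X * evenPoly c ε (m - 2))
      omega
    · have alt := alternatingCoeffs_evenPoly (ε := ε) hr hcf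
      rw [sub_eq_add_neg]
      refine (alt _).1.coeff_add_ne_zero
        ((alt _).1.neg_X_mul (sq_nonneg_of_im_eq_zero (hr _))) ?_
      obtain ⟨d, hd⟩ : ∃ d, indepNumber c (2 * m - 1) = d + 1 :=
        ⟨indepNumber c (2 * m - 1) - 1, by omega⟩
      rw [hd, coeff_neg, mul_assoc, coeff_C_mul, coeff_X_mul]
      refine neg_ne_zero.mpr (mul_ne_zero (pow_ne_zero 2 (hb _ (by omega) le_rfl)) ?_)
      exact hlow (m - 2) (by omega) (fun j hj hj' => hb j hj (by omega))
        (fun k hk hk' => ha k hk (by omega)) d (by push_cast [hd] at hS; omega)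

end
end ExtendedFFD

theorem mainTheorem3 (N : ℕ) (c : ExtendedFFD.Vertex → ℂ)
    (hc : ∀ v, v ∉ ExtendedFFD.vertexSet (2 * (N : ℤ) + 1) → c v = 0) :
    -- the products over even holes are central and square to scalars
    (∀ m : ℤ, 2 ≤ m → m ≤ N →
      ExtendedFFD.opMu (ExtendedFFD.gen N c) m ∈
          Subalgebra.center ℂ (ExtendedFFD.ExtAlgebra N c) ∧
        ExtendedFFD.opMu (ExtendedFFD.gen N c) m ^ 2 =
          algebraMap ℂ (ExtendedFFD.ExtAlgebra N c) (ExtendedFFD.scalarMu c m ^ 2)) ∧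
    -- `S_{2m}²` and `C_{2m-2}²` are scalars
    (∀ m : ℤ, 1 ≤ m → m ≤ N →
      ExtendedFFD.opS (ExtendedFFD.gen N c) m ^ 2 =
          algebraMap ℂ (ExtendedFFD.ExtAlgebra N c) (ExtendedFFD.scalarS c m) ∧
        ExtendedFFD.opC (ExtendedFFD.gen N c) (m - 1) ^ 2 =
          -algebraMap ℂ (ExtendedFFD.ExtAlgebra N c) (ExtendedFFD.scalarC c m)) ∧
    -- the value of the independence number `S_M`
    (∀ M : ℤ, 0 ≤ M → M ≤ 2 * N + 1 →
      (∀ j : ℤ, 1 ≤ j → j ≤ M → c (ExtendedFFD.Vertex.ffd j) ≠ 0) →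
      (c (ExtendedFFD.Vertex.bar 0) = 0 → (ExtendedFFD.indepNumber c M : ℤ) = (M + 2) / 3) ∧
        (c (ExtendedFFD.Vertex.bar 0) ≠ 0 → (ExtendedFFD.indepNumber c M : ℤ) = M / 3 + 1)) ∧
    -- for each choice of the signs of the even-hole scalars, there are polynomials `P_M` with
    ∀ ε : ℤ → ℤˣ, ∃ P : ℤ → Polynomial ℂ,
      -- the initial values
      (∀ M : ℤ, M < 0 → P M = 1) ∧
      P 0 = 1 - Polynomial.C (c (ExtendedFFD.Vertex.bar 0) ^ 2) * Polynomial.X ∧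
      -- the recursion for even index
      (∀ m : ℤ, 1 ≤ m → m ≤ N →
        P (2 * m) = P (2 * m - 2)
          - Polynomial.C (ExtendedFFD.scalarS c m) * Polynomial.X * P (2 * m - 4)
          + Polynomial.C (ExtendedFFD.scalarA c ε m) * Polynomial.X ^ 2 * P (2 * m - 6)
          - Polynomial.C (ExtendedFFD.scalarC c m) * Polynomial.X ^ 2 * P (2 * m - 8)) ∧
      -- the recursion for odd index
      (∀ m : ℤ, 1 ≤ m → m ≤ N + 1 →
        P (2 * m - 1) = P (2 * m - 2)
          - Polynomial.C (c (ExtendedFFD.Vertex.ffd (2 * m - 1)) ^ 2) * Polynomial.X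
            * P (2 * m - 4)) ∧
      -- degree `S_M` for real couplings without accidental zeros
      ((∀ v, (c v).im = 0) →
        ∀ M : ℤ, 0 ≤ M → M ≤ 2 * N + 1 →
          (∀ j : ℤ, 1 ≤ j → j ≤ M → c (ExtendedFFD.Vertex.ffd j) ≠ 0) →
          (∀ m : ℤ, 2 ≤ m → 2 * m ≤ M → ExtendedFFD.scalarA c ε m ≠ 0) →
          (P M).natDegree = ExtendedFFD.indepNumber c M) ∧
      -- in every representation in which the even-hole products are the chosen scalars
      ∀ (A : Type*) [Ring A] [Nontrivial A] [Algebra ℂ A]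
        (ρ : ExtendedFFD.ExtAlgebra N c →ₐ[ℂ] A),
        (∀ m : ℤ, 2 ≤ m → m ≤ N →
          ρ (ExtendedFFD.opMu (ExtendedFFD.gen N c) m) =
            algebraMap ℂ A (((ε m : ℤ) : ℂ) * ExtendedFFD.scalarMu c m)) →
        -- `A_{2m-1}²` is a scalar
        (∀ m : ℤ, 1 ≤ m → m ≤ N →
          ρ (ExtendedFFD.opA (ExtendedFFD.gen N c) m) ^ 2 =
            algebraMap ℂ A (ExtendedFFD.scalarA c ε m)) ∧
        -- the inversion relation, and the degree in terms of the highest charge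
        ∀ M : ℤ, -2 ≤ M → M ≤ 2 * N + 1 →
          (∀ u : ℂ, ρ (ExtendedFFD.transfer N c M u) * ρ (ExtendedFFD.transfer N c M (-u)) =
            (P M).eval (u ^ 2) • (1 : A)) ∧
          (P M).natDegree ≤ ExtendedFFD.indepNumber c M ∧
          ((P M).natDegree = ExtendedFFD.indepNumber c M ↔
            ρ (ExtendedFFD.charge N c M (ExtendedFFD.indepNumber c M)) ^ 2 ≠ 0) := by
  have hcf (j : ℤ) (hj : j < 1) : c (ExtendedFFD.Vertex.ffd j) = 0 :=
    hc _ (by rw [ExtendedFFD.ffd_mem_vertexSet]; omega)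
  have hcb (k : ℤ) (hk : k < 0) : c (ExtendedFFD.Vertex.bar k) = 0 :=
    hc _ (by rw [ExtendedFFD.bar_mem_vertexSet]; omega)
  have H := ExtendedFFD.isFrustrated_gen N c
  refine ⟨fun m _ _ => ⟨?_, ?_⟩, fun m _ _ => ⟨?_, ?_⟩,
    fun M hM _ hb => ExtendedFFD.indepNumber_eq hM hb, fun ε =>
    ⟨ExtendedFFD.inversionPoly c ε, ?_, ?_, ?_, ?_, ?_, ?_⟩⟩
  · exact ExtendedFFD.mem_center_of_forall_gen fun v => H.opMu_exchange m v
  · rw [pow_two, H.opMu_sq]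
  · rw [pow_two, H.opS_sq]
  · rw [pow_two, H.opC_sq]
  · intro M hM
    rcases Int.even_or_odd' M with ⟨m, rfl | rfl⟩
    · rw [ExtendedFFD.inversionPoly_even, ExtendedFFD.evenPoly_neg c ε (by omega)]
    · obtain ⟨m, rfl⟩ : ∃ k, m = k - 1 := ⟨m + 1, by ring⟩
      rw [show 2 * (m - 1) + 1 = 2 * m - 1 by ring, ExtendedFFD.inversionPoly_odd,
        ExtendedFFD.evenPoly_neg c ε (by omega), hcf (2 * m - 1) (by omega)]
      simp
  · have := ExtendedFFD.inversionPoly_even c ε 0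
    rw [mul_zero] at this
    rw [this, ExtendedFFD.evenPoly_zero hcf]
  · intro m hm _
    have e1 := ExtendedFFD.inversionPoly_even c ε (m - 1)
    have e2 := ExtendedFFD.inversionPoly_even c ε (m - 2)
    have e3 := ExtendedFFD.inversionPoly_even c ε (m - 3)
    have e4 := ExtendedFFD.inversionPoly_even c ε (m - 4)
    rw [mul_sub] at e1 e2 e3 e4
    norm_num at e1 e2 e3 e4
    rw [ExtendedFFD.inversionPoly_even, ExtendedFFD.evenPoly_step c ε (by omega), e1, e2, e3, e4]
  · intro m hm _
    have e1 := ExtendedFFD.inversionPoly_even c ε (m - 1)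
    have e2 := ExtendedFFD.inversionPoly_even c ε (m - 2)
    rw [mul_sub] at e1 e2
    norm_num at e1 e2
    rw [ExtendedFFD.inversionPoly_odd, e1, e2]
  · exact fun hr M hM _ hb ha => ExtendedFFD.natDegree_inversionPoly hr hcf hM hb ha
  · intro A _ _ _ ρ hμ
    have Hρ := H.map ρ
    have hopA (m : ℤ) : ExtendedFFD.opA (fun v => ρ (ExtendedFFD.gen N c v)) m
        = ρ (ExtendedFFD.opA (ExtendedFFD.gen N c) m) := by
      simp [ExtendedFFD.opA]
    have hopMu (m : ℤ) : ExtendedFFD.opMu (fun v => ρ (ExtendedFFD.gen N c v)) m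
        = ρ (ExtendedFFD.opMu (ExtendedFFD.gen N c) m) := by
      simp [ExtendedFFD.opMu]
    -- outside the range of the even holes, both sides of the relation for `μ` vanish
    have hμ' (m : ℤ) : ExtendedFFD.opMu (fun v => ρ (ExtendedFFD.gen N c v)) m
        = algebraMap ℂ A (((ε m : ℤ) : ℂ) * ExtendedFFD.scalarMu c m) := by
      by_cases hm : 2 ≤ m ∧ m ≤ N
      · rw [hopMu, hμ m hm.1 hm.2]
      · have h0 : c (ExtendedFFD.Vertex.ffd (2 * m - 2)) = 0 ∨
            c (ExtendedFFD.Vertex.bar m) = 0 := by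
          by_cases hm2 : m < 2
          · exact .inl (hcf _ (by omega))
          · exact .inr (hc _ (by rw [ExtendedFFD.bar_mem_vertexSet]; omega))
        rcases h0 with h0 | h0 <;>
          simp [ExtendedFFD.opMu, ExtendedFFD.scalarMu, h0, H.absent _ h0]
    have hA (m : ℤ) : ExtendedFFD.opA (fun v => ρ (ExtendedFFD.gen N c v)) m ^ 2
        = algebraMap ℂ A (ExtendedFFD.scalarA c ε m) := by
      rw [pow_two, Hρ.opA_sq m (hμ' m)]
    refine ⟨fun m _ _ => by rw [← hopA, hA], fun M _ _ => ?_⟩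
    have hinv (u : ℂ) : ρ (ExtendedFFD.transfer N c M u) * ρ (ExtendedFFD.transfer N c M (-u))
        = ((ExtendedFFD.inversionPoly c ε M).eval (u ^ 2)) • (1 : A) := by
      rw [ExtendedFFD.map_transfer, ExtendedFFD.map_transfer, neg_smul, neg_neg,
        Hρ.inversion hcf hcb hA M u, Algebra.algebraMap_eq_smul_one]
    refine ⟨hinv, ?_⟩
    refine ExtendedFFD.natDegree_of_inversion (n := (ExtendedFFD.vertexSet M).card)
      (q := fun k => ρ (ExtendedFFD.charge N c M k)) (ExtendedFFD.map_charge_zero ρ M)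
      (fun k hk => ExtendedFFD.charge_eq_zero ρ hk) (fun k hk => ?_) fun u => ?_
    · refine ExtendedFFD.charge_eq_zero ρ (lt_of_le_of_lt ?_ hk)
      obtain ⟨S, -, hSM, -, hcard⟩ := ExtendedFFD.exists_card_eq_indepNumber c M
      rw [← hcard]
      exact Finset.card_le_card hSM
    · rw [← hinv u]
      simp only [ExtendedFFD.transfer, map_sum, map_smul, neg_neg]
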